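/- Let $n\ge 1$, let $q\in\mathbb{C}$ with $0<|q|<1$, and let $q^{1/2}$ be the principal square root. Let $\mathcal D_x(a,b,c,d\,|\,q,t)$ be Koornwinder's $q$-difference operator $$\mathcal D_x=\sum_{i=1}^n \frac{(1-ax_i)(1-bx_i)(1-cx_i)(1-dx_i)}{\alpha t^{n-1}(1-x_i^2)(1-qx_i^2)}\prod_{j\ne i}\frac{(1-tx_ix_j)(1-tx_i/x_j)}{(1-x_ix_j)(1-x_i/x_j)}\,(T_{q,x_i}-1)$$ $$\qquad+\sum_{i=1}^n \frac{(1-a/x_i)(1-b/x_i)(1-c/x_i)(1-d/x_i)}{\alpha t^{n-1}(1-1/x_i^2)(1-q/x_i^2)}\prod_{j\ne i}\frac{(1-tx_j/x_i)(1-t/x_ix_j)}{(1-x_j/x_i)(1-1/x_ix_j)}\,(T_{q,x_i}^{-1}-1),$$ where $\alpha=(abcd/q)^{1/2}$ and $T_{q,x_i}^{\pm1}$ substitutes $x_i\mapsto q^{\pm1}x_i$. For a partition $\lambda=(\lambda_1\ge\dots\ge\lambda_n\ge0)$ let $m_\lambda$ be the sum of $x^\mu$ over the orbit of $\lambda$ under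 the group of signed permutations. The Koornwinder polynomial $P_\lambda(x\,|\,a,b,c,d\,|\,q,t)$ is the Laurent polynomial characterized by $P_\lambda=m_\lambda+{}$(a linear combination of $m_\mu$ with $\mu<\lambda$ in dominance order: $\mu_1+\dots+\mu_k\le\lambda_1+\dots+\lambda_k$ for $1\le k\le n$) and $\mathcal D_xP_\lambda=d_\lambda P_\lambda$, where $d_\lambda=\sum_{j=1}^n\bigl(\alpha t^{n-j}q^{\lambda_j}+\alpha^{-1}t^{j-n}q^{-\lambda_j}-\alpha t^{n-j}-\alpha^{-1}t^{j-n}\bigr)$. Put $$P^{(C_n,C_n)}_\lambda(x\,|\,b;q,t)=P_\lambda(x\,|\,b^{1/2},-b^{1/2},q^{1/2}b^{1/2},-q^{1/2}b^{1/2}\,|\,q,t),\qquad P^{(D_n,D_n)}_\lambda(x\,|\,q,t)=P_\lambda(x\,|\,1,-1,q^{1/2},-q^{1/2}\,|\,q,t).$$ Let $s^{(D_n)}_\lambda$ be the irreducible character of type $D_n$ with highest weight $\lambda$ (given by Weyl's character formula) if $\lambda_n=0$, and the sum of the two irreducible characters with highest weights $(\lambda_1,\dots,\lambda_{n-1},\pm\lambda_n)$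 if $\lambda_n>0$. Define $E_r(x)$ by $\prod_{i=1}^n(1-yx_i)(1-y/x_i)=\sum_{r\ge0}(-1)^rE_r(x)y^r$. Then the following hold. 1. For every partition $\lambda$ with at most $n$ parts, $s^{(D_n)}_\lambda$ is a Laurent polynomial that satisfies the conditions characterizing $P^{(C_n,C_n)}_\lambda(x\,|\,1;q,q)$ and $P^{(D_n,D_n)}_\lambda(x\,|\,q,q)$; it is the only one that does so whenever $d_\mu\ne d_\lambda$ for all partitions $\mu<\lambda$ (with $a=1$, $b=-1$, $c=q^{1/2}$, $d=-q^{1/2}$, $t=q$), as is the case for generic $q$. 2. Let $$f(s)=\frac{(1-1/s)(1-t^2/sa^2c^2)(1+t/sa^2)(1+t/sc^2)}{(1-t/s^2a^2c^2)(1-t^3/s^2a^2c^2)}.$$ At $a=1$, $c=q^{1/2}$, $t=q$ (that is, $b=1$, $t=q$) the rational function $f(t)$ of $(a,c,t)$ takes the value $2$, and $f(t^{i+1})$ takes the value $1$ for every $i>0$, in the sense of limits at that point along parameters where the denominators do not vanish. 3. With these values, the recursion relations $$\mathcal C_{0,0}=1,\qquad \mathcal C_{i-1,i-1}=\mathcal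 C_{i,i}\ (i\ge1),\qquad f(t)\,\mathcal C_{1,j-1}=\mathcal C_{0,j}\ (j=2,4,6,\dots),$$ $$\mathcal C_{i-1,j-1}+f(t^{i+1})\,\mathcal C_{i+1,j-1}=\mathcal C_{i,j}\quad(i+j\text{ even},\ 0<i<j)$$ for matrices $(\mathcal C_{i,j})_{i,j\ge0}$ with $\mathcal C_{i,j}=0$ if $i>j$ or if $i+j$ is odd become the ones of the half of Pascal's triangle: their unique solution is $\mathcal C_{i,j}=\binom{j}{(j-i)/2}$ for $i\le j$, $i+j$ even (and $\mathcal C_{i,j}=0$ otherwise). 4. For $0\le r\le n$ and $\lambda=(1^r)$, the polynomials $P^{(C_n,C_n)}_{(1^r)}(x\,|\,1;q,q)$ and $P^{(D_n,D_n)}_{(1^r)}(x\,|\,q,q)$ exist and are unique, and $$s^{(D_n)}_{(1^r)}(x)=P^{(C_n,C_n)}_{(1^r)}(x\,|\,1;q,q)=P^{(D_n,D_n)}_{(1^r)}(x\,|\,q,q)=E_r(x)=\sum_{k=0}^{\lfloor r/2\rfloor}\binom{n-r+2k}{k}\,m_{(1^{r-2k})}(x).$$ -/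

import Mathlib

open Filter Topology

noncomputable section

namespace KoornwinderD

/-! ### Laurent polynomials and rational functions in `x₁, …, xₙ` -/

/-- The ring `ℂ[x₁^{±1}, …, xₙ^{±1}]` of Laurent polynomials, as the group algebra of `ℤⁿ`.
The index `i : Fin n` stands for the (1-based) index `i + 1`. -/
abbrev Laurent (n : ℕ) : Type := AddMonoidAlgebra ℂ (Fin n → ℤ)

/-- The field `ℂ(x₁, …, xₙ)` of rational functions. -/
abbrev RatFun (n : ℕ) : Type := FractionRing (Laurent n)

/-- A Laurent polynomial regarded as a rational function. -/
def toRat {n : ℕ} (P : Laurent n) : RatFun n := algebraMap (Laurent n) (RatFun n) P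

/-- The monomial `x^μ = x₁^{μ₁} ⋯ xₙ^{μₙ}`. -/
def mono {n : ℕ} (μ : Fin n → ℤ) : Laurent n := AddMonoidAlgebra.single μ 1

/-- The variable `x_i`, as a rational function. -/
def xvar {n : ℕ} (i : Fin n) : RatFun n := toRat (mono (Pi.single i 1))

/-- A complex constant, as a rational function. -/
def const {n : ℕ} (z : ℂ) : RatFun n := algebraMap ℂ (RatFun n) z

/-- The substitution `x_i ↦ u x_i` in a Laurent polynomial, where `u ≠ 0`;
`T_{q,x_i}^{+1}` is the case `u = q` and `T_{q,x_i}^{-1}` is the case `u = q⁻¹`. -/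
def qshift {n : ℕ} (u : ℂ) (i : Fin n) (P : Laurent n) : Laurent n :=
  ∑ μ ∈ P.coeff.support, AddMonoidAlgebra.single μ (u ^ (μ i) * P.coeff μ)

/-! ### Partitions, the Weyl groups and the monomial symmetric polynomials -/

/-- Partitions `λ₁ ≥ ⋯ ≥ λₙ ≥ 0` with at most `n` parts, padded by zeros. -/
def IsPartition {n : ℕ} (lam : Fin n → ℤ) : Prop := Antitone lam ∧ ∀ i, 0 ≤ lam i

/-- The one-column partition `(1^r)`, for `r ≤ n`. -/
def col (n r : ℕ) : Fin n → ℤ := fun i => if (i : ℕ) < r then 1 else 0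

/-- Dominance ordering `μ ≤ λ`: `μ₁ + ⋯ + μ_k ≤ λ₁ + ⋯ + λ_k` for `k = 1, …, n`
(equivalently, `λ - μ` lies in the positive cone of the root lattice of type `BCₙ`). -/
def DomLE {n : ℕ} (mu lam : Fin n → ℤ) : Prop :=
  ∀ k : Fin n, ∑ i ∈ Finset.Iic k, mu i ≤ ∑ i ∈ Finset.Iic k, lam i

/-- Strict dominance. -/
def DomLT {n : ℕ} (mu lam : Fin n → ℤ) : Prop := DomLE mu lam ∧ mu ≠ lam

/-- The Weyl group of type `BCₙ` consists of the signed permutations, given by a permutation and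
signs; this is their action on `ℤⁿ`. -/
def signedPerm {n : ℕ} (w : Equiv.Perm (Fin n) × (Fin n → ℤˣ)) (mu : Fin n → ℤ) : Fin n → ℤ :=
  fun i => (w.2 i : ℤ) * mu (w.1 i)

/-- The orbit of `λ` under the Weyl group of type `BCₙ`. -/
def orbit {n : ℕ} (lam : Fin n → ℤ) : Finset (Fin n → ℤ) :=
  Finset.univ.image fun w : Equiv.Perm (Fin n) × (Fin n → ℤˣ) => signedPerm w lam

/-- The monomial symmetric polynomial `m_λ` of type `Cₙ`: the orbit sum of `x^λ`. -/
def msym {n : ℕ} (lam : Fin n → ℤ) : Laurent n := ∑ mu ∈ orbit lam, mono mu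

/-! ### Koornwinder and Macdonald polynomials -/

/-- `α = (abcd/q)^{1/2}`. (The other root changes the sign of both the operator and its
eigenvalues.) -/
def alpha (a b c d q : ℂ) : ℂ := (a * b * c * d / q) ^ (1 / 2 : ℂ)

/-- The coefficient of `T_{q,x_i}^{+1} - 1` in Koornwinder's operator. -/
def koornCoeffPlus {n : ℕ} (a b c d q t : ℂ) (i : Fin n) : RatFun n :=
  (1 - const a * xvar i) * (1 - const b * xvar i) * (1 - const c * xvar i) *
      (1 - const d * xvar i) /
    (const (alpha a b c d q * t ^ (n - 1)) * (1 - xvar i ^ 2) * (1 - const q * xvar i ^ 2)) *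
  ∏ j ∈ Finset.univ.erase i,
    ((1 - const t * xvar i * xvar j) * (1 - const t * xvar i / xvar j)) /
      ((1 - xvar i * xvar j) * (1 - xvar i / xvar j))

/-- The coefficient of `T_{q,x_i}^{-1} - 1` in Koornwinder's operator. -/
def koornCoeffMinus {n : ℕ} (a b c d q t : ℂ) (i : Fin n) : RatFun n :=
  (1 - const a / xvar i) * (1 - const b / xvar i) * (1 - const c / xvar i) *
      (1 - const d / xvar i) /
    (const (alpha a b c d q * t ^ (n - 1)) * (1 - 1 / xvar i ^ 2) * (1 - const q / xvar i ^ 2)) *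
  ∏ j ∈ Finset.univ.erase i,
    ((1 - const t * xvar j / xvar i) * (1 - const t / (xvar i * xvar j))) /
      ((1 - xvar j / xvar i) * (1 - 1 / (xvar i * xvar j)))

/-- Koornwinder's `q`-difference operator `𝒟_x(a,b,c,d|q,t)`, on Laurent polynomials. -/
def koornOp {n : ℕ} (a b c d q t : ℂ) (P : Laurent n) : RatFun n :=
  ∑ i, koornCoeffPlus a b c d q t i * (toRat (qshift q i P) - toRat P) +
  ∑ i, koornCoeffMinus a b c d q t i * (toRat (qshift q⁻¹ i P) - toRat P)

/-- The eigenvalue `d_λ = ∑_j ⟨α t^{n-j} q^{λ_j}; α t^{n-j}⟩`, with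
`⟨z; w⟩ = z + z⁻¹ - w - w⁻¹`. -/
def koornEigenvalue {n : ℕ} (a b c d q t : ℂ) (lam : Fin n → ℤ) : ℂ :=
  ∑ j : Fin n,
    (alpha a b c d q * t ^ (n - 1 - (j : ℕ)) * q ^ (lam j) +
      (alpha a b c d q * t ^ (n - 1 - (j : ℕ)) * q ^ (lam j))⁻¹ -
      alpha a b c d q * t ^ (n - 1 - (j : ℕ)) -
      (alpha a b c d q * t ^ (n - 1 - (j : ℕ)))⁻¹)

/-- The two conditions which characterize the Koornwinder polynomial `P_λ(x|a,b,c,d|q,t)`: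
it is `m_λ` plus terms that are lower in the dominance ordering, and it is an eigenfunction of
Koornwinder's operator with eigenvalue `d_λ`. -/
structure IsKoornwinder {n : ℕ} (a b c d q t : ℂ) (lam : Fin n → ℤ) (P : Laurent n) : Prop where
  triangular : P - msym lam ∈
    Submodule.span ℂ {m : Laurent n | ∃ mu, IsPartition mu ∧ DomLT mu lam ∧ m = msym mu}
  eigen : koornOp a b c d q t P = const (koornEigenvalue a b c d q t lam) * toRat P

/-- `P` is the Macdonald polynomial `P_λ^{(Cₙ,Cₙ)}(x|b;q,t)`. -/
def IsMacdonaldCC {n : ℕ} (b q t : ℂ) (lam : Fin n → ℤ) (P : Laurent n) : Prop :=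
  IsKoornwinder (b ^ (1 / 2 : ℂ)) (-b ^ (1 / 2 : ℂ))
    (q ^ (1 / 2 : ℂ) * b ^ (1 / 2 : ℂ)) (-(q ^ (1 / 2 : ℂ) * b ^ (1 / 2 : ℂ))) q t lam P

/-- `P` is the Macdonald polynomial `P_λ^{(Dₙ,Dₙ)}(x|q,t)`. -/
def IsMacdonaldDD {n : ℕ} (q t : ℂ) (lam : Fin n → ℤ) (P : Laurent n) : Prop :=
  IsKoornwinder 1 (-1) (q ^ (1 / 2 : ℂ)) (-q ^ (1 / 2 : ℂ)) q t lam P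

/-- The eigenvalue `d_λ` belonging to `P_λ^{(Dₙ,Dₙ)}(x|q,t) = P_λ^{(Cₙ,Cₙ)}(x|1;q,t)`. -/
def eigenvalueDD {n : ℕ} (q t : ℂ) (lam : Fin n → ℤ) : ℂ :=
  koornEigenvalue 1 (-1) (q ^ (1 / 2 : ℂ)) (-q ^ (1 / 2 : ℂ)) q t lam

/-! ### Schur polynomials of type `Dₙ` -/

/-- The alternating sum `∑_w det(w) x^{wμ}` over the Weyl group of type `Dₙ`, which consists of
the signed permutations with an even number of sign changes; `det(w)` is the sign of the
underlying permutation. -/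
def altSumD {n : ℕ} (mu : Fin n → ℤ) : Laurent n :=
  ∑ w : Equiv.Perm (Fin n) × (Fin n → ℤˣ) with ∏ i, w.2 i = 1,
    ((Equiv.Perm.sign w.1 : ℤˣ) : ℤ) • mono (signedPerm w mu)

/-- The half sum `ρ = (n-1, …, 1, 0)` of the positive roots of type `Dₙ`. -/
def rhoD (n : ℕ) : Fin n → ℤ := fun i => (n : ℤ) - 1 - (i : ℕ)

/-- The irreducible character of type `Dₙ` of highest weight
`λ₁ ≥ ⋯ ≥ λ_{n-1} ≥ |λₙ|`, by Weyl's character formula. -/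
def charD {n : ℕ} (lam : Fin n → ℤ) : RatFun n :=
  toRat (altSumD (lam + rhoD n)) / toRat (altSumD (rhoD n))

/-- `(λ₁, …, λ_{n-1}, λₙ) ↦ (λ₁, …, λ_{n-1}, -λₙ)`. -/
def flipLast {n : ℕ} (lam : Fin n → ℤ) : Fin n → ℤ :=
  fun i => if (i : ℕ) + 1 = n then -lam i else lam i

/-- The Schur polynomial `s_λ^{(Dₙ)}` attached to a partition `λ`. It is the irreducible
character of highest weight `λ` if `ℓ(λ) < n`. If `ℓ(λ) = n`, the orbit of `λ` under
the Weyl group of type `Cₙ` splits into two orbits for type `Dₙ`, and `s_λ^{(Dₙ)}` is the sum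
of the two irreducible characters of highest weights `(λ₁, …, ±λₙ)`. -/
def schurD {n : ℕ} (lam : Fin n → ℤ) : RatFun n :=
  if ∀ i, lam i ≠ 0 then charD lam + charD (flipLast lam) else charD lam

/-! ### The polynomials `E_r` -/

/-- `E(x|y) = ∏_i (1 - y x_i)(1 - y/x_i)`, a polynomial in `y` over the Laurent polynomials. -/
def genE (n : ℕ) : Polynomial (Laurent n) :=
  ∏ i : Fin n, (1 - Polynomial.X * Polynomial.C (mono (Pi.single i 1))) *
    (1 - Polynomial.X * Polynomial.C (mono (Pi.single i (-1))))

/-- `E_r`, defined by `E(x|y) = ∑_r (-1)^r E_r(x) y^r`. -/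
def Epoly (n r : ℕ) : Laurent n := (-1) ^ r * (genE n).coeff r

/-! ### The deformed Catalan triangle -/

/-- The denominator of `f(s)`. -/
def fDen (a c t s : ℂ) : ℂ :=
  (1 - t / (s ^ 2 * a ^ 2 * c ^ 2)) * (1 - t ^ 3 / (s ^ 2 * a ^ 2 * c ^ 2))

/-- The function `f(s)`, which depends on the parameters `a`, `c`, `t`. -/
def f (a c t s : ℂ) : ℂ :=
  (1 - 1 / s) * (1 - t ^ 2 / (s * a ^ 2 * c ^ 2)) * (1 + t / (s * a ^ 2)) *
    (1 + t / (s * c ^ 2)) / fDen a c t s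

/-- The rational function `f(t^{i+1})` of `(a, c, t)` takes the value `v` at the point `p`:
off the zero set of its denominator, it tends to `v` at `p`. (The numerator and the denominator
may have a common factor that vanishes at `p`.) -/
def FHasValueAt (i : ℕ) (p : ℂ × ℂ × ℂ) (v : ℂ) : Prop :=
  (𝓝[{z : ℂ × ℂ × ℂ | z.1 ≠ 0 ∧ z.2.1 ≠ 0 ∧ z.2.2 ≠ 0 ∧
      fDen z.1 z.2.1 z.2.2 (z.2.2 ^ (i + 1)) ≠ 0}] p).NeBot ∧
  Tendsto (fun z : ℂ × ℂ × ℂ => f z.1 z.2.1 z.2.2 (z.2.2 ^ (i + 1)))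
    (𝓝[{z : ℂ × ℂ × ℂ | z.1 ≠ 0 ∧ z.2.1 ≠ 0 ∧ z.2.2 ≠ 0 ∧
      fDen z.1 z.2.1 z.2.2 (z.2.2 ^ (i + 1)) ≠ 0}] p) (𝓝 v)

/-- The even upper triangular matrices `𝒞` that satisfy the deformed Catalan triangle
recursion relations, where `g i` is the coefficient `f(t^{i+1})`. -/
structure IsDeformedCatalanTriangle (g : ℕ → ℂ) (C : ℕ → ℕ → ℂ) : Prop where
  upper : ∀ i j, j < i → C i j = 0
  even : ∀ i j, Odd (i + j) → C i j = 0
  zero_zero : C 0 0 = 1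
  diag : ∀ i, 1 ≤ i → C (i - 1) (i - 1) = C i i
  first_row : ∀ j, 2 ≤ j → Even j → g 0 * C 1 (j - 1) = C 0 j
  step : ∀ i j, Even (i + j) → 0 < i → i < j →
    C (i - 1) (j - 1) + g i * C (i + 1) (j - 1) = C i j

end KoornwinderD

end

noncomputable section

namespace KoornwinderD

/-! ### Monomials and the action of the signed permutations -/

/-! Everything rests on conjugation by the Weyl denominator Δ = `altC (rhoD n)`. At `(a,b,c,d) =
(1,-1,q^{1/2},-q^{1/2})` one has `α = 1`, and the numerator `(1-x²)(1-qx²)` cancels the one-variable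
denominator. At `t = q` the remaining product is `T_{q,x_i}Δ / Δ`, because Δ is, up to sign, a
Vandermonde determinant in the `x_i + x_i⁻¹`. Hence Δ𝒟P is `∑ (T_{q,x_i} + T_{q,x_i}⁻¹)(ΔP)` minus a
scalar multiple of ΔP (`koornOp_typeD`). The shift operator is diagonal on monomials, with an
eigenvalue constant on signed-permutation orbits, so each `altC (λ + ρ)` is an eigenfunction.

The eigenfunction sought is therefore `altC (λ + ρ) / Δ`. That it is a Laurent polynomial,
unitriangular in the `m_μ`, follows by induction on dominance (`exists_schur`), since alternating
polynomials are determined by their strictly dominant coefficients. Uniqueness uses the same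
principle and distinct eigenvalues (`IsMacdonaldDD.unique`). Splitting sign vectors by parity
identifies the quotient with the type D character, or with the sum of two characters
(`schurD_eq_of_mul_eq`).

For one column, the relation `E(x|x_j⁻¹) = 0` writes `x_j^n + x_j^{-n}` as a combination of the rows
of Δ, and Cramer's rule gives `Δ E_r = altC ((1^r) + ρ)`. The eigenvalues below `(1^r)` telescope
and are distinct since `0 < |q| < 1`. The values of `f` and the Pascal triangle are separate direct
computations. -/

lemma coeff_mono {n : ℕ} (μ ν : Fin n → ℤ) : (mono μ).coeff ν = if μ = ν then 1 else 0 := by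
  classical
  rw [mono, AddMonoidAlgebra.coeff_single, Finsupp.single_apply]

lemma mono_add {n : ℕ} (μ ν : Fin n → ℤ) : mono (μ + ν) = mono μ * mono ν := by
  simp [mono, AddMonoidAlgebra.single_mul_single]

lemma mono_zero {n : ℕ} : mono (0 : Fin n → ℤ) = 1 := rfl

lemma mono_sum {n : ℕ} {ι : Type*} (s : Finset ι) (μ : ι → Fin n → ℤ) :
    mono (∑ i ∈ s, μ i) = ∏ i ∈ s, mono (μ i) := by
  classical
  induction s using Finset.induction_on with
  | empty => simp [mono_zero]
  | insert a s ha ih => rw [Finset.sum_insert ha, Finset.prod_insert ha, mono_add, ih]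

lemma prod_mono_single {n : ℕ} (p : Fin n → ℤ) :
    ∏ i, mono (Pi.single i (p i) : Fin n → ℤ) = mono p := by
  rw [← mono_sum, Finset.univ_sum_single]

/-- A signed permutation as an automorphism of `ℤⁿ`. -/
def signedPermHom {n : ℕ} (w : Equiv.Perm (Fin n) × (Fin n → ℤˣ)) :
    (Fin n → ℤ) →+ (Fin n → ℤ) where
  toFun := signedPerm w
  map_zero' := by ext; simp [signedPerm]
  map_add' a b := by ext; simp [signedPerm, mul_add]

lemma signedPerm_injective {n : ℕ} (w : Equiv.Perm (Fin n) × (Fin n → ℤˣ)) :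
    Function.Injective (signedPerm w) := by
  intro a b h
  ext i
  have := congrFun h (w.1.symm i)
  simpa [signedPerm] using this

lemma abs_unit_mul (u : ℤˣ) (a : ℤ) : |(u : ℤ) * a| = |a| := by
  rcases Int.units_eq_one_or u with rfl | rfl <;> simp

lemma abs_signedPerm {n : ℕ} (w : Equiv.Perm (Fin n) × (Fin n → ℤˣ)) (μ : Fin n → ℤ) (i : Fin n) :
    |signedPerm w μ i| = |μ (w.1 i)| := abs_unit_mul _ _

lemma exists_unit_mul_eq {a b : ℤ} (h : |a| = |b|) : ∃ u : ℤˣ, (u : ℤ) * b = a := by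
  rcases abs_eq_abs.1 h with h | h
  · exact ⟨1, by simp [h]⟩
  · exact ⟨-1, by simp [h]⟩

lemma exists_signedPerm_eq {n : ℕ} {μ ν : Fin n → ℤ} {σ : Equiv.Perm (Fin n)}
    (h : ∀ i, |ν i| = |μ (σ i)|) : ∃ ε : Fin n → ℤˣ, signedPerm (σ, ε) μ = ν := by
  choose ε hε using fun i => exists_unit_mul_eq (h i)
  exact ⟨ε, funext hε⟩

/-- Absolute values absorb the signs, so that only the permutation has to be tracked. -/
lemma mem_orbit {n : ℕ} {μ ν : Fin n → ℤ} :
    ν ∈ orbit μ ↔ ∃ σ : Equiv.Perm (Fin n), ∀ i, |ν i| = |μ (σ i)| := by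
  simp only [orbit, Finset.mem_image, Finset.mem_univ, true_and]
  constructor
  · rintro ⟨w, rfl⟩
    exact ⟨w.1, abs_signedPerm w μ⟩
  · rintro ⟨σ, h⟩
    obtain ⟨ε, h⟩ := exists_signedPerm_eq h
    exact ⟨_, h⟩

lemma coeff_msym {n : ℕ} (μ ν : Fin n → ℤ) :
    (msym μ).coeff ν = if ν ∈ orbit μ then 1 else 0 := by
  classical
  simp [msym, AddMonoidAlgebra.coeff_sum, Finsupp.finsetSum_apply, coeff_mono]

lemma signedPerm_mem_orbit {n : ℕ} (w : Equiv.Perm (Fin n) × (Fin n → ℤˣ)) {μ ν : Fin n → ℤ} :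
    signedPerm w ν ∈ orbit μ ↔ ν ∈ orbit μ := by
  simp only [mem_orbit, abs_signedPerm]
  constructor
  · rintro ⟨σ, h⟩
    exact ⟨σ * w.1⁻¹, fun i => by simpa using h (w.1⁻¹ i)⟩
  · rintro ⟨σ, h⟩
    exact ⟨σ * w.1, fun i => by simpa using h (w.1 i)⟩

/-- The action of a signed permutation on Laurent polynomials. -/
def act {n : ℕ} (w : Equiv.Perm (Fin n) × (Fin n → ℤˣ)) : Laurent n →+* Laurent n :=
  AddMonoidAlgebra.mapDomainRingHom ℂ (signedPermHom w)

lemma coeff_act {n : ℕ} (w : Equiv.Perm (Fin n) × (Fin n → ℤˣ)) (F : Laurent n)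
    (ν : Fin n → ℤ) : (act w F).coeff (signedPerm w ν) = F.coeff ν :=
  Finsupp.mapDomain_apply (signedPerm_injective w) F.coeff ν

lemma signedPerm_surjective {n : ℕ} (w : Equiv.Perm (Fin n) × (Fin n → ℤˣ)) :
    Function.Surjective (signedPerm w) := by
  intro ν
  refine ⟨fun i => (w.2 (w.1.symm i) : ℤ) * ν (w.1.symm i), ?_⟩
  ext i
  simp [signedPerm, ← mul_assoc]

/-- Alternating Laurent polynomials: a signed permutation acts by the sign of the underlying
permutation. -/
def IsAlt {n : ℕ} (F : Laurent n) : Prop :=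
  ∀ (w : Equiv.Perm (Fin n) × (Fin n → ℤˣ)) (ν : Fin n → ℤ),
    F.coeff (signedPerm w ν) = ((Equiv.Perm.sign w.1 : ℤ) : ℂ) * F.coeff ν

lemma sign_mul_self {n : ℕ} (σ : Equiv.Perm (Fin n)) :
    ((Equiv.Perm.sign σ : ℤ) : ℂ) * ((Equiv.Perm.sign σ : ℤ) : ℂ) = 1 := by
  rcases Int.units_eq_one_or (Equiv.Perm.sign σ) with h | h <;> simp [h]

/-- Moving coefficients forward or back along `w` gives the same sign, as signs square to 1. In this
form stability under multiplication by an invariant is immediate. -/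
lemma isAlt_iff {n : ℕ} {F : Laurent n} :
    IsAlt F ↔ ∀ w, act w F = ((Equiv.Perm.sign w.1 : ℤ) : ℂ) • F := by
  refine forall_congr' fun w => ?_
  rw [← AddMonoidAlgebra.coeff_inj (y := _ • F), DFunLike.ext_iff,
    (signedPerm_surjective w).forall (p := fun ν => (act w F).coeff ν = _)]
  refine forall_congr' fun ν => ?_
  rw [coeff_act, AddMonoidAlgebra.coeff_smul_apply, smul_eq_mul]
  constructor
  · intro h
    rw [h, ← mul_assoc, sign_mul_self, one_mul]
  · intro h
    rw [h, ← mul_assoc, sign_mul_self, one_mul]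

lemma act_msym {n : ℕ} (w : Equiv.Perm (Fin n) × (Fin n → ℤˣ)) (μ : Fin n → ℤ) :
    act w (msym μ) = msym μ := by
  rw [← AddMonoidAlgebra.coeff_inj, DFunLike.ext_iff, (signedPerm_surjective w).forall]
  intro ν
  simp only [coeff_act, coeff_msym, signedPerm_mem_orbit]

lemma IsAlt.mul_msym {n : ℕ} {F : Laurent n} (hF : IsAlt F) (μ : Fin n → ℤ) :
    IsAlt (F * msym μ) := by
  rw [isAlt_iff] at hF ⊢
  intro w
  rw [map_mul, hF, act_msym, smul_mul_assoc]

lemma isAlt_zero {n : ℕ} : IsAlt (0 : Laurent n) := by intro w ν; simp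

lemma IsAlt.add {n : ℕ} {F G : Laurent n} (hF : IsAlt F) (hG : IsAlt G) : IsAlt (F + G) := by
  intro w ν
  simp only [AddMonoidAlgebra.coeff_add, Finsupp.add_apply, hF w ν, hG w ν, mul_add]

lemma IsAlt.smul {n : ℕ} {F : Laurent n} (c : ℂ) (hF : IsAlt F) : IsAlt (c • F) := by
  intro w ν
  simp only [AddMonoidAlgebra.coeff_smul_apply, hF w ν, smul_eq_mul]
  ring

lemma IsAlt.sub {n : ℕ} {F G : Laurent n} (hF : IsAlt F) (hG : IsAlt G) : IsAlt (F - G) := by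
  intro w ν
  simp only [AddMonoidAlgebra.coeff_sub, Finsupp.sub_apply, hF w ν, hG w ν, mul_sub]

lemma isAlt_sum {n : ℕ} {ι : Type*} (s : Finset ι) {F : ι → Laurent n}
    (h : ∀ i ∈ s, IsAlt (F i)) : IsAlt (∑ i ∈ s, F i) := by
  classical
  induction s using Finset.induction_on with
  | empty => simpa using isAlt_zero
  | insert a s ha ih =>
    rw [Finset.sum_insert ha]
    exact (h a (by simp)).add (ih fun i hi => h i (by simp [hi]))

/-! ### Strictly dominant weights -/

/-- Strictly decreasing sequences of nonnegative integers, that is, `λ + ρ` for a partition `λ`. -/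
def IsStrict {n : ℕ} (κ : Fin n → ℤ) : Prop := StrictAnti κ ∧ ∀ i, 0 ≤ κ i

lemma IsPartition.add_rhoD {n : ℕ} {lam : Fin n → ℤ} (h : IsPartition lam) :
    IsStrict (lam + rhoD n) := by
  constructor
  · intro i j hij
    have := h.1 hij.le
    have hij' : (i : ℕ) < j := hij
    simp only [Pi.add_apply, rhoD]
    omega
  · intro i
    have := h.2 i
    simp only [Pi.add_apply, rhoD]
    omega

lemma isPartition_zero {n : ℕ} : IsPartition (0 : Fin n → ℤ) :=
  ⟨fun _ _ _ => le_rfl, fun _ => le_rfl⟩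

lemma isStrict_rhoD (n : ℕ) : IsStrict (rhoD n) := by
  simpa using (isPartition_zero (n := n)).add_rhoD

lemma IsStrict.sub_rhoD {n : ℕ} {κ : Fin n → ℤ} (h : IsStrict κ) : IsPartition (κ - rhoD n) := by
  have hanti : Antitone (κ - rhoD n) := by
    cases n with
    | zero => intro i; exact i.elim0
    | succ n =>
      rw [Fin.antitone_iff_succ_le]
      intro i
      have := h.1 (Fin.castSucc_lt_succ (i := i))
      simp [rhoD]
      omega
  refine ⟨hanti, fun i => ?_⟩
  cases n with
  | zero => exact i.elim0
  | succ n =>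
    have h1 := hanti (Fin.le_last i)
    have h2 := h.2 (Fin.last n)
    simp only [Pi.sub_apply, rhoD, Fin.val_last] at h1 ⊢
    push_cast at h1 ⊢
    omega

lemma perm_eq_one_of_strictMono {n : ℕ} {σ : Equiv.Perm (Fin n)} (h : StrictMono σ) : σ = 1 := by
  have := Subsingleton.elim (h.orderIsoOfSurjective σ σ.surjective) (OrderIso.refl _)
  ext i
  exact congrArg Fin.val (DFunLike.congr_fun this i)

/-- Between nonnegative sequences the signs drop out, and a permutation carrying one strictly
decreasing sequence to another is order preserving, hence trivial. This makes strictly dominant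
coefficients of `altC` a Kronecker delta. -/
lemma IsStrict.eq_of_abs_eq {n : ℕ} {κ κ' : Fin n → ℤ} (h : IsStrict κ) (h' : IsStrict κ')
    {σ : Equiv.Perm (Fin n)} (hσ : ∀ i, |κ' i| = |κ (σ i)|) : σ = 1 ∧ κ' = κ := by
  have hκ : ∀ i, κ' i = κ (σ i) := fun i => by
    rw [← abs_of_nonneg (h'.2 i), hσ, abs_of_nonneg (h.2 _)]
  have hs : σ = 1 := perm_eq_one_of_strictMono fun i j hij => by
    have := h'.1 hij
    rw [hκ, hκ] at this
    exact h.1.lt_iff_gt.1 this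
  subst hs
  exact ⟨rfl, funext hκ⟩

lemma exists_antitone_abs_comp {n : ℕ} (ν : Fin n → ℤ) :
    ∃ (σ : Equiv.Perm (Fin n)), Antitone fun i => |ν (σ i)| := by
  refine ⟨Tuple.sort fun i => -|ν i|, fun i j hij => ?_⟩
  simpa using Tuple.monotone_sort (fun i => -|ν i|) hij

/-- An alternating Laurent polynomial is determined by its strictly dominant coefficients. -/
lemma IsAlt.eq_zero {n : ℕ} {F : Laurent n} (hF : IsAlt F)
    (h : ∀ κ, IsStrict κ → F.coeff κ = 0) : F = 0 := by
  rw [← AddMonoidAlgebra.coeff_eq_zero]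
  ext ν
  rw [Finsupp.zero_apply]
  -- If the `|ν i|` are distinct, a signed permutation moves `ν` to a strictly dominant weight.
  -- Otherwise a transposition with suitable signs fixes `ν`, and the coefficient equals its own
  -- negative.
  by_cases hinj : Function.Injective fun i => |ν i|
  · obtain ⟨σ, hσ⟩ := exists_antitone_abs_comp ν
    have hst : IsStrict fun i => |ν (σ i)| := by
      refine ⟨hσ.strictAnti_of_injective fun i j hij => σ.injective (hinj hij), fun i => abs_nonneg _⟩
    obtain ⟨ε, hε⟩ := exists_signedPerm_eq (μ := ν) (ν := fun i => |ν (σ i)|) (σ := σ)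
      fun i => abs_abs _
    have h1 := hF (σ, ε) ν
    rw [hε, h _ hst] at h1
    have := sign_mul_self σ
    rcases mul_eq_zero.1 h1.symm with h2 | h2
    · rw [h2] at this
      simp at this
    · exact h2
  · simp only [Function.Injective, not_forall] at hinj
    obtain ⟨i, j, hij, hne⟩ := hinj
    obtain ⟨ε, hε⟩ := exists_signedPerm_eq (μ := ν) (ν := ν) (σ := Equiv.swap i j) (by
      intro k
      rcases eq_or_ne k i with rfl | hki
      · simpa using hij
      · rcases eq_or_ne k j with rfl | hkj
        · simpa using hij.symm
        · rw [Equiv.swap_apply_of_ne_of_ne hki hkj])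
    have h1 := hF (Equiv.swap i j, ε) ν
    rw [hε, Equiv.Perm.sign_swap hne] at h1
    simpa [self_eq_neg] using h1

/-! ### The alternating polynomials attached to strictly dominant weights -/

/-- `x_i^m + x_i^{-m}`, or `1` if `m = 0`. -/
def cosMono {n : ℕ} (i : Fin n) (m : ℤ) : Laurent n :=
  ∑ e ∈ ({m, -m} : Finset ℤ), mono (Pi.single i e)

/-- The determinant of the `cosMono i (κ a)`. -/
def altC {n : ℕ} (κ : Fin n → ℤ) : Laurent n :=
  (Matrix.of fun a i => cosMono i (κ a)).det

/-- Each product of entries expands into distinct monomials, one per choice of exponents. Since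
`cosMono` sums over the set `{m, -m}`, a zero exponent is counted once, not twice. -/
lemma coeff_altC {n : ℕ} (κ ν : Fin n → ℤ) :
    (altC κ).coeff ν = ∑ σ : Equiv.Perm (Fin n),
      if ∀ i, |ν i| = |κ (σ i)| then ((Equiv.Perm.sign σ : ℤ) : ℂ) else 0 := by
  classical
  rw [altC, Matrix.det_apply, AddMonoidAlgebra.coeff_sum, Finsupp.finsetSum_apply]
  refine Finset.sum_congr rfl fun σ _ => ?_
  simp only [Matrix.of_apply, cosMono]
  rw [Finset.prod_univ_sum]
  simp only [prod_mono_single]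
  have h1 : (∑ p ∈ Fintype.piFinset fun i => ({κ (σ i), -κ (σ i)} : Finset ℤ),
      mono p).coeff ν = if ∀ i, |ν i| = |κ (σ i)| then 1 else 0 := by
    rw [AddMonoidAlgebra.coeff_sum, Finsupp.finsetSum_apply]
    simp only [coeff_mono, Finset.sum_ite_eq', Fintype.mem_piFinset, Finset.mem_insert,
      Finset.mem_singleton, abs_eq_abs]
  rw [Units.smul_def, AddMonoidAlgebra.coeff_smul, Finsupp.smul_apply, h1]
  split_ifs <;> simp

lemma isAlt_altC {n : ℕ} (κ : Fin n → ℤ) : IsAlt (altC κ) := by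
  classical
  intro w ν
  rw [coeff_altC, coeff_altC, Finset.mul_sum]
  refine Fintype.sum_equiv (Equiv.mulRight w.1⁻¹) _ _ fun σ => ?_
  have : (∀ i, |signedPerm w ν i| = |κ (σ i)|) ↔
      ∀ i, |ν i| = |κ ((Equiv.mulRight w.1⁻¹ σ) i)| := by
    simp only [abs_signedPerm]
    constructor
    · intro h i
      simpa using h (w.1⁻¹ i)
    · intro h i
      simpa using h (w.1 i)
  simp only [this]
  split_ifs
  · rcases Int.units_eq_one_or (Equiv.Perm.sign w.1) with h | h <;> simp [h]
  · simp

lemma coeff_altC_strict {n : ℕ} {κ κ' : Fin n → ℤ} (h : IsStrict κ) (h' : IsStrict κ') :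
    (altC κ).coeff κ' = if κ' = κ then 1 else 0 := by
  classical
  rw [coeff_altC]
  split_ifs with hk
  · subst hk
    rw [Finset.sum_eq_single 1]
    · simp
    · intro σ _ hσ
      exact if_neg fun hh => hσ (h.eq_of_abs_eq h' hh).1
    · simp
  · exact Finset.sum_eq_zero fun σ _ => if_neg fun hh => hk (h.eq_of_abs_eq h' hh).2

lemma mem_orbit_of_coeff_altC_ne_zero {n : ℕ} {κ ν : Fin n → ℤ} (h : (altC κ).coeff ν ≠ 0) :
    ν ∈ orbit κ := by
  rw [coeff_altC] at h
  obtain ⟨σ, -, hσ⟩ := Finset.exists_ne_zero_of_sum_ne_zero h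
  exact mem_orbit.2 ⟨σ, by by_contra hh; exact hσ (if_neg hh)⟩

/-! ### The dominance ordering -/

lemma DomLE.refl {n : ℕ} (μ : Fin n → ℤ) : DomLE μ μ := fun _ => le_rfl

lemma DomLE.trans {n : ℕ} {μ ν κ : Fin n → ℤ} (h : DomLE μ ν) (h' : DomLE ν κ) : DomLE μ κ :=
  fun k => (h k).trans (h' k)

lemma DomLE.antisymm {n : ℕ} {μ ν : Fin n → ℤ} (h : DomLE μ ν) (h' : DomLE ν μ) : μ = ν := by
  ext k
  have hk : ∀ k, ∑ i ∈ Finset.Iic k, μ i = ∑ i ∈ Finset.Iic k, ν i :=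
    fun k => le_antisymm (h k) (h' k)
  induction k using WellFoundedLT.induction with
  | ind k ih =>
    have h1 := hk k
    rw [← Finset.Iio_insert, Finset.sum_insert (by simp), Finset.sum_insert (by simp),
      Finset.sum_congr rfl fun i hi => ih i (Finset.mem_Iio.1 hi)] at h1
    exact add_right_cancel h1

lemma DomLE.add {n : ℕ} {μ ν μ' ν' : Fin n → ℤ} (h : DomLE μ ν) (h' : DomLE μ' ν') :
    DomLE (μ + μ') (ν + ν') := fun k => by
  simpa only [Pi.add_apply, Finset.sum_add_distrib] using add_le_add (h k) (h' k)

lemma domLE_add_right {n : ℕ} {μ ν κ : Fin n → ℤ} : DomLE (μ + κ) (ν + κ) ↔ DomLE μ ν := by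
  simp only [DomLE, Pi.add_apply, Finset.sum_add_distrib, add_le_add_iff_right]

lemma DomLE.trans_lt {n : ℕ} {μ ν κ : Fin n → ℤ} (h : DomLE μ ν) (h' : DomLT ν κ) : DomLT μ κ :=
  ⟨h.trans h'.1, fun hh => h'.2 (h'.1.antisymm (hh ▸ h))⟩

/-- Removing signs can only increase a partial sum, and the rearrangement inequality against the
indicator of `{i ≤ k}` shows that the decreasing order maximizes it. -/
lemma domLE_of_mem_orbit {n : ℕ} {μ ν : Fin n → ℤ} (hμ : Antitone μ) (h0 : ∀ i, 0 ≤ μ i)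
    (h : ν ∈ orbit μ) : DomLE ν μ := by
  classical
  obtain ⟨σ, hσ⟩ := mem_orbit.1 h
  intro k
  have h1 : ∑ i ∈ Finset.Iic k, ν i ≤ ∑ i ∈ Finset.Iic k, μ (σ i) :=
    Finset.sum_le_sum fun i _ => by
      rw [← abs_of_nonneg (h0 (σ i)), ← hσ]
      exact le_abs_self _
  refine h1.trans ?_
  have hmono : Monovary (fun i => if i ≤ k then (1 : ℤ) else 0) μ := by
    intro i j hij
    have hlt : j < i := hμ.reflect_lt hij
    by_cases hi : i ≤ k
    · simp [hi, hlt.le.trans hi]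
    · dsimp only
      rw [if_neg hi]
      split_ifs <;> simp
  have h2 := hmono.sum_mul_comp_perm_le_sum_mul (σ := σ)
  have hconv : ∀ f : Fin n → ℤ, ∑ i, (if i ≤ k then (1 : ℤ) else 0) * f i =
      ∑ i ∈ Finset.Iic k, f i := fun f => by
    simp only [ite_mul, one_mul, zero_mul]
    rw [← Finset.sum_filter]
    congr 1
    ext
    simp
  rwa [hconv, hconv] at h2

lemma self_mem_orbit {n : ℕ} (μ : Fin n → ℤ) : μ ∈ orbit μ := mem_orbit.2 ⟨1, fun _ => rfl⟩

/-! ### Products of the Weyl denominator with monomial symmetric polynomials -/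

lemma exists_of_coeff_mul_ne_zero {n : ℕ} {F G : Laurent n} {κ : Fin n → ℤ}
    (h : (F * G).coeff κ ≠ 0) : ∃ a b, F.coeff a ≠ 0 ∧ G.coeff b ≠ 0 ∧ a + b = κ := by
  classical
  rw [AddMonoidAlgebra.coeff_mul, Finsupp.sum] at h
  obtain ⟨a, ha, h⟩ := Finset.exists_ne_zero_of_sum_ne_zero h
  rw [Finsupp.sum] at h
  obtain ⟨b, hb, h⟩ := Finset.exists_ne_zero_of_sum_ne_zero h
  refine ⟨a, b, Finsupp.mem_support_iff.1 ha, Finsupp.mem_support_iff.1 hb, ?_⟩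
  by_contra hab
  exact h (if_neg hab)

lemma domLE_rhoD {n : ℕ} {a : Fin n → ℤ} (h : (altC (rhoD n)).coeff a ≠ 0) : DomLE a (rhoD n) :=
  domLE_of_mem_orbit (isStrict_rhoD n).1.antitone (isStrict_rhoD n).2
    (mem_orbit_of_coeff_altC_ne_zero h)

lemma domLE_of_coeff_msym {n : ℕ} {μ b : Fin n → ℤ} (hμ : IsPartition μ)
    (h : (msym μ).coeff b ≠ 0) : DomLE b μ := by
  rw [coeff_msym] at h
  exact domLE_of_mem_orbit hμ.1 hμ.2 (by by_contra hh; exact h (if_neg hh))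

/-- Dominance is additive: exponents of the Weyl denominator lie below `ρ`, and those of `m_μ` below
`μ`. -/
lemma domLE_of_coeff_mul_msym {n : ℕ} {μ ν : Fin n → ℤ} (hμ : IsPartition μ)
    (h : (altC (rhoD n) * msym μ).coeff (ν + rhoD n) ≠ 0) : DomLE ν μ := by
  obtain ⟨a, b, ha, hb, hab⟩ := exists_of_coeff_mul_ne_zero h
  have h1 := (domLE_of_coeff_msym hμ hb).add (domLE_rhoD ha)
  rwa [add_comm b a, hab, domLE_add_right] at h1

/-- The top exponent `μ + ρ` arises only as the sum of the two top exponents, by antisymmetry of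
dominance. -/
lemma coeff_altC_mul_msym_self {n : ℕ} {μ : Fin n → ℤ} (hμ : IsPartition μ) :
    (altC (rhoD n) * msym μ).coeff (μ + rhoD n) = 1 := by
  rw [add_comm, AddMonoidAlgebra.coeff_mul_add_of_uniqueAdd,
    coeff_altC_strict (isStrict_rhoD n) (isStrict_rhoD n), if_pos rfl, coeff_msym,
    if_pos (self_mem_orbit μ), one_mul]
  intro a b ha hb hab
  have h1 := domLE_rhoD (Finsupp.mem_support_iff.1 ha)
  have h2 := domLE_of_coeff_msym hμ (Finsupp.mem_support_iff.1 hb)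
  have h3 : DomLE (rhoD n) a := by
    rw [← domLE_add_right (κ := b), hab]
    exact (DomLE.refl _).add h2
  have h4 := h1.antisymm h3
  subst h4
  exact ⟨rfl, add_left_cancel hab⟩

/-- The span of the monomial symmetric polynomials below `λ`. -/
def lowerSpan {n : ℕ} (lam : Fin n → ℤ) : Submodule ℂ (Laurent n) :=
  Submodule.span ℂ {m : Laurent n | ∃ mu, IsPartition mu ∧ DomLT mu lam ∧ m = msym mu}

lemma msym_mem_lowerSpan {n : ℕ} {μ lam : Fin n → ℤ} (hμ : IsPartition μ) (h : DomLT μ lam) :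
    msym μ ∈ lowerSpan lam := Submodule.subset_span ⟨μ, hμ, h, rfl⟩

lemma lowerSpan_mono {n : ℕ} {μ lam : Fin n → ℤ} (h : DomLE μ lam) :
    lowerSpan μ ≤ lowerSpan lam := by
  refine Submodule.span_mono ?_
  rintro _ ⟨ν, hν, hlt, rfl⟩
  exact ⟨ν, hν, ⟨hlt.1.trans h, fun hh => hlt.2 (hlt.1.antisymm (hh ▸ h))⟩, rfl⟩

lemma isAlt_altC_mul_lowerSpan {n : ℕ} {lam : Fin n → ℤ} {R : Laurent n}
    (hR : R ∈ lowerSpan lam) : IsAlt (altC (rhoD n) * R) := by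
  induction hR using Submodule.span_induction with
  | mem x hx =>
    obtain ⟨μ, -, -, rfl⟩ := hx
    exact (isAlt_altC _).mul_msym μ
  | zero => simpa using isAlt_zero
  | add x y _ _ hx hy => rw [mul_add]; exact hx.add hy
  | smul c x _ hx => rw [mul_smul_comm]; exact hx.smul c

lemma domLT_of_coeff_altC_mul {n : ℕ} {lam ν : Fin n → ℤ} {R : Laurent n}
    (hR : R ∈ lowerSpan lam) (h : (altC (rhoD n) * R).coeff (ν + rhoD n) ≠ 0) :
    DomLT ν lam := by
  by_contra hlt
  refine h ?_
  clear h
  induction hR using Submodule.span_induction with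
  | mem x hx =>
    obtain ⟨μ, hμ, hμl, rfl⟩ := hx
    by_contra h
    exact hlt (DomLE.trans_lt (domLE_of_coeff_mul_msym hμ h) hμl)
  | zero => simp
  | add x y _ _ hx hy => rw [mul_add, AddMonoidAlgebra.coeff_add, Finsupp.add_apply, hx, hy, add_zero]
  | smul c x _ hx => rw [mul_smul_comm, AddMonoidAlgebra.coeff_smul_apply, hx, smul_zero]

/-- The sum of all partial sums, which is strictly monotone for the dominance ordering. -/
def height {n : ℕ} (ν : Fin n → ℤ) : ℤ := ∑ k : Fin n, ∑ i ∈ Finset.Iic k, ν i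

lemma DomLT.height_lt {n : ℕ} {μ ν : Fin n → ℤ} (h : DomLT μ ν) : height μ < height ν := by
  refine lt_of_le_of_ne (Finset.sum_le_sum fun k _ => h.1 k) fun hh => h.2 (h.1.antisymm ?_)
  intro k
  exact ((Finset.sum_eq_sum_iff_of_le fun k _ => h.1 k).1 hh k (Finset.mem_univ k)).ge

lemma IsPartition.height_nonneg {n : ℕ} {μ : Fin n → ℤ} (h : IsPartition μ) : 0 ≤ height μ :=
  Finset.sum_nonneg fun _ _ => Finset.sum_nonneg fun i _ => h.2 i

/-- The Schur polynomials: there is a polynomial, unitriangular with respect to the monomial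
symmetric polynomials, whose product with the Weyl denominator is `altC (λ + ρ)`. -/
lemma exists_schur {n : ℕ} {lam : Fin n → ℤ} (hlam : IsPartition lam) :
    ∃ s : Laurent n, s - msym lam ∈ lowerSpan lam ∧
      altC (rhoD n) * s = altC (lam + rhoD n) := by
  classical
  obtain ⟨N, hN⟩ : ∃ N : ℕ, height lam = N := ⟨_, (Int.toNat_of_nonneg hlam.height_nonneg).symm⟩
  induction N using Nat.strong_induction_on generalizing lam with
  | _ N ih =>
  -- A total choice of `s ν`, with the default 0 outside the partitions below `λ`, so that `choose`
  -- applies.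
  have ih' : ∀ ν : Fin n → ℤ, ∃ s : Laurent n, IsPartition ν → DomLT ν lam →
      s - msym ν ∈ lowerSpan ν ∧ altC (rhoD n) * s = altC (ν + rhoD n) := by
    intro ν
    by_cases h : IsPartition ν ∧ DomLT ν lam
    · have h1 := h.2.height_lt
      have h2 := h.1.height_nonneg
      obtain ⟨s, hs⟩ := ih (height ν).toNat (by omega) h.1 (by omega)
      exact ⟨s, fun _ _ => hs⟩
    · exact ⟨0, fun h1 h2 => absurd ⟨h1, h2⟩ h⟩
  choose s hs using ih'
  set F := altC (rhoD n) * msym lam with hF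
  set S : Finset (Fin n → ℤ) :=
    (F.coeff.support.image fun κ => κ - rhoD n).filter fun ν => IsPartition ν ∧ DomLT ν lam with hS
  have hSmem : ∀ ν ∈ S, IsPartition ν ∧ DomLT ν lam := fun ν h => (Finset.mem_filter.1 h).2
  -- Expansion of `Δ m_λ` in the `altC (ν + ρ)`: both sides are alternating and agree at strictly
  -- dominant weights. Solving for the leading term leaves only `ν < λ`, where the induction
  -- hypothesis supplies quotients by Δ.
  have hsF : altC (lam + rhoD n) = F - ∑ ν ∈ S, F.coeff (ν + rhoD n) • altC (ν + rhoD n) := by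
    have hlamS : lam ∉ S := fun h => (hSmem _ h).2.2 rfl
    have hins : F - ∑ ν ∈ insert lam S, F.coeff (ν + rhoD n) • altC (ν + rhoD n) = 0 := by
      refine IsAlt.eq_zero (((isAlt_altC _).mul_msym lam).sub
        (isAlt_sum _ fun ν _ => (isAlt_altC _).smul _)) fun κ hκ => ?_
      rw [AddMonoidAlgebra.coeff_sub, Finsupp.sub_apply, AddMonoidAlgebra.coeff_sum,
        Finsupp.finsetSum_apply]
      have hterm : ∀ ν ∈ insert lam S, (F.coeff (ν + rhoD n) • altC (ν + rhoD n)).coeff κ =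
          if ν = κ - rhoD n then F.coeff κ else 0 := by
        intro ν hν
        have hνp : IsPartition ν := by
          rcases Finset.mem_insert.1 hν with rfl | h
          · exact hlam
          · exact (hSmem _ h).1
        rw [AddMonoidAlgebra.coeff_smul_apply, coeff_altC_strict hνp.add_rhoD hκ, smul_eq_mul]
        by_cases hk : κ = ν + rhoD n
        · rw [if_pos hk, mul_one, if_pos (by rw [hk, add_sub_cancel_right]), hk]
        · rw [if_neg hk, mul_zero, if_neg fun h => hk (by rw [h, sub_add_cancel])]
      rw [Finset.sum_congr rfl hterm, Finset.sum_ite_eq', sub_eq_zero]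
      split_ifs with hmem
      · rfl
      · by_contra hne
        refine hmem (Finset.mem_insert.2 ?_)
        by_cases heq : κ - rhoD n = lam
        · exact Or.inl heq
        · refine Or.inr (Finset.mem_filter.2 ⟨Finset.mem_image.2
            ⟨κ, Finsupp.mem_support_iff.2 hne, rfl⟩, hκ.sub_rhoD, ?_, heq⟩)
          exact domLE_of_coeff_mul_msym hlam (by rwa [sub_add_cancel])
    rw [Finset.sum_insert hlamS, coeff_altC_mul_msym_self hlam, one_smul, ← sub_sub,
      sub_right_comm, sub_eq_zero] at hins
    exact hins.symm
  refine ⟨msym lam - ∑ ν ∈ S, F.coeff (ν + rhoD n) • s ν, ?_, ?_⟩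
  · rw [sub_sub_cancel_left]
    refine neg_mem (sum_mem fun ν hν => Submodule.smul_mem _ _ ?_)
    obtain ⟨h1, h2⟩ := hSmem ν hν
    rw [← sub_add_cancel (s ν) (msym ν)]
    exact add_mem (lowerSpan_mono h2.1 (hs ν h1 h2).1) (msym_mem_lowerSpan h1 h2)
  · rw [mul_sub, Finset.mul_sum, hsF]
    congr 1
    refine Finset.sum_congr rfl fun ν hν => ?_
    rw [mul_smul_comm, (hs ν (hSmem ν hν).1 (hSmem ν hν).2).2]

/-! ### The product formula for the Weyl denominator -/

/-- The variable `x_i + x_i⁻¹`. -/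
def zvar {n : ℕ} (i : Fin n) : Laurent n := mono (Pi.single i 1) + mono (Pi.single i (-1))

lemma mono_single_mul_neg {n : ℕ} (i : Fin n) (m : ℤ) :
    mono (Pi.single i m : Fin n → ℤ) * mono (Pi.single i (-m)) = 1 := by
  rw [← mono_add, ← Pi.single_add, add_neg_cancel, Pi.single_zero, mono_zero]

lemma mono_single_pow {n : ℕ} (i : Fin n) (m : ℤ) (k : ℕ) :
    mono (Pi.single i m : Fin n → ℤ) ^ k = mono (Pi.single i (k * m)) := by
  induction k with
  | zero => simp [mono_zero]
  | succ k ih => rw [pow_succ, ih, ← mono_add, ← Pi.single_add]; push_cast; ring_nf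

lemma cosMono_zero {n : ℕ} (i : Fin n) : cosMono i 0 = 1 := by
  simp [cosMono, mono_zero]

lemma cosMono_of_ne_zero {n : ℕ} (i : Fin n) {m : ℤ} (hm : m ≠ 0) :
    cosMono i m = mono (Pi.single i m) + mono (Pi.single i (-m)) := by
  rw [cosMono, Finset.sum_pair]
  omega

open Polynomial in
-- Induction along `D_{m+2} = X D_{m+1} - D_m`. The member of index 0 is the constant 2, which need
-- not be monic; hence the shifted index and the bare degree bound at `m`.
lemma monic_dickson_one_one {R : Type*} [CommRing R] [Nontrivial R] (m : ℕ) :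
    (dickson 1 (1 : R) (m + 1)).Monic ∧ (dickson 1 (1 : R) (m + 1)).natDegree = m + 1 ∧
      (dickson 1 (1 : R) m).degree ≤ m := by
  induction m with
  | zero =>
    refine ⟨by simp, by simp, ?_⟩
    rw [dickson_zero]
    have : (3 - ((1 : ℕ) : R[X])) = C 2 := by
      rw [map_ofNat]
      norm_num
    rw [this]
    exact degree_C_le
  | succ m ih =>
    obtain ⟨h1, h2, h3⟩ := ih
    have hX : (X * dickson 1 (1 : R) (m + 1)).Monic := monic_X.mul h1
    have hdeg : (X * dickson 1 (1 : R) (m + 1)).degree = ((m + 1 + 1 : ℕ) : WithBot ℕ) := by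
      rw [degree_eq_natDegree hX.ne_zero, monic_X.natDegree_mul h1, h2, natDegree_X, add_comm]
    have hlt : (C (1 : R) * dickson 1 (1 : R) m).degree < (X * dickson 1 (1 : R) (m + 1)).degree := by
      rw [hdeg, C_1, one_mul]
      refine lt_of_le_of_lt h3 ?_
      exact_mod_cast (by omega : m < m + 1 + 1)
    rw [dickson_add_two]
    refine ⟨hX.sub_of_left hlt, ?_, ?_⟩
    · refine natDegree_eq_of_degree_eq_some ?_
      rw [degree_sub_eq_left_of_degree_lt hlt, hdeg]
    · rw [degree_eq_natDegree h1.ne_zero, h2]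

open Polynomial in
/-- Up to sign, the Weyl denominator is the Vandermonde determinant in the `x_i + x_i⁻¹`. -/
lemma exists_altC_rhoD_eq (n : ℕ) :
    ∃ u : ℤˣ, altC (rhoD n) = ((u : ℤ) : Laurent n) * (Matrix.vandermonde (zvar (n := n))).det := by
  -- Dickson polynomials express `x^j + x^{-j}` in `x + x⁻¹`. At `j = 0` they give 2, whereas
  -- `cosMono i 0 = 1`, so the constant 1 is used there.
  set p : Fin n → (Laurent n)[X] := fun j =>
    if (j : ℕ) = 0 then 1 else dickson 1 (1 : Laurent n) j with hp
  have hdeg : ∀ j, (p j).natDegree = j ∧ (p j).Monic := by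
    intro j
    rcases Nat.eq_zero_or_eq_succ_pred (j : ℕ) with h | h
    · simp [hp, h]
    · have := monic_dickson_one_one (R := Laurent n) (Nat.pred j)
      rw [hp]
      dsimp only
      rw [if_neg (by omega), h]
      exact ⟨this.2.1, this.1⟩
  have heval : ∀ i j, (p j).eval (zvar i) = cosMono i ((j : ℕ) : ℤ) := by
    intro i j
    by_cases h : (j : ℕ) = 0
    · simp [hp, h, cosMono_zero]
    · have hz : ((j : ℕ) : ℤ) ≠ 0 := by exact_mod_cast h
      rw [cosMono_of_ne_zero i hz, hp]
      dsimp only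
      rw [if_neg h, zvar, dickson_one_one_eval_add_inv _ _ (mono_single_mul_neg i 1),
        mono_single_pow, mono_single_pow, mul_one, mul_neg, mul_one]
  rw [Matrix.det_eval_matrixOfPolynomials_eq_det_vandermonde _ p (fun i => (hdeg i).1)
    (fun i => (hdeg i).2)]
  -- The exponents `ρ` decrease while Vandermonde exponents increase; the unit is the sign of the
  -- reversal.
  refine ⟨Equiv.Perm.sign (Fin.revPerm (n := n)), ?_⟩
  rw [← Matrix.det_transpose (Matrix.of _), ← Matrix.det_permute, altC]
  congr 1
  ext1 a i
  simp only [Matrix.of_apply, Matrix.submatrix_apply, Matrix.transpose_apply, id, heval, rhoD,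
    Fin.revPerm_apply, Fin.val_rev]
  congr 1
  omega

/-- All factors not involving node `i` go into `c`. As `c` does not depend on `a`, it cancels in the
ratio of a shifted and an unshifted determinant. -/
lemma exists_det_vandermonde_update {K : Type*} [CommRing K] {n : ℕ} (v : Fin n → K)
    (i : Fin n) : ∃ c : K, ∀ a : K,
      (Matrix.vandermonde (Function.update v i a)).det = c * ∏ j ∈ Finset.univ.erase i, (a - v j) := by
  classical
  have hdet : ∀ w : Fin n → K, (Matrix.vandermonde w).det =
      ∏ k, ∏ l, if k < l then w l - w k else 1 := by
    intro w
    rw [Matrix.det_vandermonde]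
    refine Finset.prod_congr rfl fun k _ => ?_
    rw [← Finset.prod_filter]
    congr 1
    ext
    simp
  refine ⟨(∏ k ∈ Finset.univ.erase i, ∏ l ∈ Finset.univ.erase i, if k < l then v l - v k else 1) *
    ∏ j ∈ Finset.univ.erase i, if i < j then -1 else 1, fun a => ?_⟩
  rw [hdet, ← Finset.mul_prod_erase _ _ (Finset.mem_univ i),
    ← Finset.mul_prod_erase _ _ (Finset.mem_univ i), if_neg (lt_irrefl i), one_mul]
  have hrow : ∀ k ∈ Finset.univ.erase i,
      (∏ l : Fin n, if k < l then Function.update v i a l - Function.update v i a k else 1) =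
        (if k < i then a - v k else 1) *
          ∏ l ∈ Finset.univ.erase i, if k < l then v l - v k else 1 := by
    intro k hk
    have hki := (Finset.mem_erase.1 hk).1
    rw [← Finset.mul_prod_erase _ _ (Finset.mem_univ i), Function.update_self,
      Function.update_of_ne hki]
    congr 1
    refine Finset.prod_congr rfl fun l hl => ?_
    rw [Function.update_of_ne (Finset.mem_erase.1 hl).1]
  rw [Finset.prod_congr rfl hrow, Finset.prod_mul_distrib, ← mul_assoc, mul_comm, mul_assoc]
  congr 1
  rw [← Finset.prod_mul_distrib, ← Finset.prod_mul_distrib]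
  refine Finset.prod_congr rfl fun j hj => ?_
  have hji := (Finset.mem_erase.1 hj).1
  rw [Function.update_self, Function.update_of_ne hji]
  rcases lt_or_gt_of_ne hji with h | h
  · rw [if_neg h.not_gt, if_pos h, if_neg h.not_gt]
  · rw [if_pos h, if_neg h.not_gt, if_pos h]
    ring

/-! ### The `q`-shifts -/

/-- The `q`-shift as a ring homomorphism. -/
def qshiftHom {n : ℕ} (u : ℂ) (hu : u ≠ 0) (i : Fin n) : Laurent n →ₐ[ℂ] Laurent n :=
  AddMonoidAlgebra.lift ℂ (Laurent n) (Fin n → ℤ)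
    { toFun := fun m => AddMonoidAlgebra.single m.toAdd (u ^ (m.toAdd i))
      map_one' := by simp [AddMonoidAlgebra.one_def]
      map_mul' := fun a b => by
        simp [AddMonoidAlgebra.single_mul_single, zpow_add₀ hu] }

lemma qshift_eq_qshiftHom {n : ℕ} {u : ℂ} (hu : u ≠ 0) (i : Fin n) (P : Laurent n) :
    qshift u i P = qshiftHom u hu i P := by
  rw [qshiftHom, AddMonoidAlgebra.lift_apply, qshift, Finsupp.sum]
  refine Finset.sum_congr rfl fun μ _ => ?_
  simp [mul_comm]

lemma coeff_qshift {n : ℕ} (u : ℂ) (i : Fin n) (P : Laurent n) (μ : Fin n → ℤ) :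
    (qshift u i P).coeff μ = u ^ (μ i) * P.coeff μ := by
  classical
  rw [qshift, AddMonoidAlgebra.coeff_sum, Finsupp.finsetSum_apply]
  simp only [AddMonoidAlgebra.coeff_single, Finsupp.single_apply]
  rw [Finset.sum_ite_eq']
  split_ifs with h
  · rfl
  · rw [Finsupp.notMem_support_iff.1 h, mul_zero]

lemma qshift_mono {n : ℕ} (u : ℂ) (i : Fin n) (μ : Fin n → ℤ) :
    qshift u i (mono μ) = u ^ (μ i) • mono μ := by
  rw [← AddMonoidAlgebra.coeff_inj]
  ext ν
  rw [coeff_qshift, AddMonoidAlgebra.coeff_smul_apply, coeff_mono, smul_eq_mul]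
  split_ifs with h
  · rw [h]
  · simp

lemma qshift_zvar_of_ne {n : ℕ} (u : ℂ) {i j : Fin n} (h : j ≠ i) :
    qshift u i (zvar j) = zvar j := by
  rw [← AddMonoidAlgebra.coeff_inj]
  ext ν
  rw [coeff_qshift, zvar, AddMonoidAlgebra.coeff_add, Finsupp.add_apply, coeff_mono, coeff_mono]
  by_cases hν : ν i = 0
  · simp [hν]
  · have h1 : ∀ e, Pi.single j e ≠ ν := by
      rintro e rfl
      exact hν (Pi.single_eq_of_ne h.symm _)
    simp [h1]

/-- The operator `∑_i (T_{q,x_i} + T_{q,x_i}^{-1})`. -/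
def shiftSum {n : ℕ} (q : ℂ) (F : Laurent n) : Laurent n :=
  ∑ i, qshift q i F + ∑ i, qshift q⁻¹ i F

/-- The eigenvalue of `shiftSum q` at the monomial `x^κ`. -/
def shiftEigen {n : ℕ} (q : ℂ) (κ : Fin n → ℤ) : ℂ := ∑ i, (q ^ κ i + (q ^ κ i)⁻¹)

lemma coeff_shiftSum {n : ℕ} (q : ℂ) (F : Laurent n) (κ : Fin n → ℤ) :
    (shiftSum q F).coeff κ = shiftEigen q κ * F.coeff κ := by
  rw [shiftSum, AddMonoidAlgebra.coeff_add, Finsupp.add_apply, AddMonoidAlgebra.coeff_sum,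
    AddMonoidAlgebra.coeff_sum, Finsupp.finsetSum_apply, Finsupp.finsetSum_apply, shiftEigen,
    Finset.sum_mul, ← Finset.sum_add_distrib]
  refine Finset.sum_congr rfl fun i _ => ?_
  rw [coeff_qshift, coeff_qshift, inv_zpow, add_mul]

lemma shiftEigen_of_mem_orbit {n : ℕ} (q : ℂ) {κ ν : Fin n → ℤ} (h : ν ∈ orbit κ) :
    shiftEigen q ν = shiftEigen q κ := by
  obtain ⟨σ, hσ⟩ := mem_orbit.1 h
  rw [shiftEigen, shiftEigen, ← Equiv.sum_comp σ fun i => q ^ κ i + (q ^ κ i)⁻¹]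
  refine Finset.sum_congr rfl fun i _ => ?_
  rcases abs_eq_abs.1 (hσ i) with h | h
  · rw [h]
  · rw [h, zpow_neg, inv_inv, add_comm]

/-- `altC κ` is supported on the single orbit of `κ`, where `shiftEigen` is constant because `q^m +
q^{-m}` is even in `m`. -/
lemma shiftSum_altC {n : ℕ} (q : ℂ) (κ : Fin n → ℤ) :
    shiftSum q (altC κ) = shiftEigen q κ • altC κ := by
  rw [← AddMonoidAlgebra.coeff_inj]
  ext ν
  rw [coeff_shiftSum, AddMonoidAlgebra.coeff_smul_apply, smul_eq_mul]
  by_cases h : (altC κ).coeff ν = 0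
  · rw [h, mul_zero, mul_zero]
  · rw [shiftEigen_of_mem_orbit q (mem_orbit_of_coeff_altC_ne_zero h)]

lemma altC_rhoD_ne_zero (n : ℕ) : altC (rhoD n) ≠ 0 := by
  intro h
  have := coeff_altC_strict (isStrict_rhoD n) (isStrict_rhoD n)
  rw [h] at this
  simp at this

/-! ### Koornwinder's operator at the parameters of type `D` -/

lemma toRat_injective {n : ℕ} : Function.Injective (toRat (n := n)) :=
  IsFractionRing.injective (Laurent n) (RatFun n)

lemma toRat_add {n : ℕ} (P Q : Laurent n) : toRat (P + Q) = toRat P + toRat Q := map_add _ _ _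

lemma toRat_sub {n : ℕ} (P Q : Laurent n) : toRat (P - Q) = toRat P - toRat Q := map_sub _ _ _

lemma toRat_mul {n : ℕ} (P Q : Laurent n) : toRat (P * Q) = toRat P * toRat Q := map_mul _ _ _

lemma toRat_one {n : ℕ} : toRat (1 : Laurent n) = 1 := map_one _

lemma toRat_sum {n : ℕ} {ι : Type*} (s : Finset ι) (P : ι → Laurent n) :
    toRat (∑ i ∈ s, P i) = ∑ i ∈ s, toRat (P i) := map_sum _ _ _

lemma toRat_smul {n : ℕ} (c : ℂ) (P : Laurent n) : toRat (c • P) = const c * toRat P := by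
  rw [toRat, toRat, const, Algebra.smul_def, map_mul, ← IsScalarTower.algebraMap_apply]

lemma const_mul {n : ℕ} (a b : ℂ) : const (n := n) (a * b) = const a * const b := map_mul _ _ _

lemma const_one {n : ℕ} : const (n := n) 1 = 1 := map_one _

lemma const_neg {n : ℕ} (a : ℂ) : const (n := n) (-a) = -const a := map_neg _ _

lemma const_inv {n : ℕ} (a : ℂ) : const (n := n) a⁻¹ = (const a)⁻¹ := map_inv₀ _ _

lemma const_pow {n : ℕ} (a : ℂ) (k : ℕ) : const (n := n) (a ^ k) = const a ^ k := map_pow _ _ _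

lemma const_ne_zero {n : ℕ} {a : ℂ} (h : a ≠ 0) : const (n := n) a ≠ 0 :=
  (map_ne_zero (algebraMap ℂ (RatFun n))).2 h

lemma toRat_mono_single {n : ℕ} (i : Fin n) :
    toRat (mono (Pi.single i (-1))) = (xvar i : RatFun n)⁻¹ := by
  refine eq_inv_of_mul_eq_one_right ?_
  rw [xvar, ← toRat_mul, mono_single_mul_neg, toRat_one]

lemma xvar_ne_zero {n : ℕ} (i : Fin n) : (xvar i : RatFun n) ≠ 0 := by
  intro h
  have : xvar i * toRat (mono (Pi.single i (-1))) = (1 : RatFun n) := by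
    rw [xvar, ← toRat_mul, mono_single_mul_neg, toRat_one]
  rw [h, zero_mul] at this
  exact zero_ne_one this

lemma toRat_zvar {n : ℕ} (i : Fin n) :
    toRat (zvar i) = xvar i + (xvar i : RatFun n)⁻¹ := by
  rw [zvar, toRat_add, toRat_mono_single, xvar]

lemma one_sub_const_mul_xvar_sq_ne_zero {n : ℕ} (c : ℂ) (i : Fin n) :
    1 - const c * xvar i ^ 2 ≠ (0 : RatFun n) := by
  have h : 1 - const c * xvar i ^ 2 = toRat (1 - c • mono (Pi.single i 2) : Laurent n) := by
    rw [toRat_sub, toRat_one, toRat_smul, xvar, pow_two, ← toRat_mul, ← mono_add,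
      ← Pi.single_add, one_add_one_eq_two]
  rw [h, show (0 : RatFun n) = toRat 0 from (map_zero _).symm, toRat_injective.ne_iff]
  intro h
  have h1 := congrArg (fun P : Laurent n => P.coeff 0) h
  have h2 : Pi.single i 2 ≠ (0 : Fin n → ℤ) := by simp
  simp [coeff_mono, h2, ← mono_zero] at h1

lemma one_sub_const_div_xvar_sq_ne_zero {n : ℕ} (c : ℂ) (i : Fin n) :
    1 - const c / xvar i ^ 2 ≠ (0 : RatFun n) := by
  by_cases hc : c = 0
  · simp [hc, const]
  · intro h
    refine one_sub_const_mul_xvar_sq_ne_zero (n := n) c⁻¹ i ?_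
    have hx := xvar_ne_zero i
    have hc' := const_ne_zero (n := n) hc
    rw [const_inv]
    field_simp at h ⊢
    linear_combination -h

/-- The ratio of the shifted Weyl denominator and the Weyl denominator. -/
lemma toRat_qshift_altC_div {n : ℕ} {u : ℂ} (hu : u ≠ 0) (i : Fin n) :
    toRat (qshift u i (altC (rhoD n))) / toRat (altC (rhoD n)) =
      ∏ j ∈ Finset.univ.erase i,
        (const u * xvar i + (const u * xvar i)⁻¹ - (xvar j + (xvar j)⁻¹)) /
          (xvar i + (xvar i)⁻¹ - (xvar j + (xvar j)⁻¹)) := by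
  classical
  obtain ⟨e, he⟩ := exists_altC_rhoD_eq n
  obtain ⟨c, hc⟩ := exists_det_vandermonde_update (zvar (n := n)) i
  have hself := hc (zvar i)
  rw [Function.update_eq_self] at hself
  -- The shift in `x_i` moves only the node `zvar i` of the Vandermonde matrix.
  have hshift : qshift u i (altC (rhoD n)) = ((e : ℤ) : Laurent n) *
      (c * ∏ j ∈ Finset.univ.erase i, (qshift u i (zvar i) - zvar j)) := by
    rw [he, ← hc, qshift_eq_qshiftHom hu, map_mul, map_intCast, AlgHom.map_det]
    congr 2
    ext1 a b
    simp only [AlgHom.mapMatrix_apply, Matrix.map_apply, Matrix.vandermonde_apply, map_pow]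
    congr 1
    rw [← qshift_eq_qshiftHom hu]
    rcases eq_or_ne a i with rfl | ha
    · rw [Function.update_self]
    · rw [Function.update_of_ne ha, qshift_zvar_of_ne u ha]
  have hne : toRat (((e : ℤ) : Laurent n) * c) ≠ 0 := by
    rw [show (0 : RatFun n) = toRat 0 from (map_zero _).symm, toRat_injective.ne_iff]
    intro h
    refine altC_rhoD_ne_zero n ?_
    rw [he, hself, ← mul_assoc, h, zero_mul]
  have hzi : toRat (qshift u i (zvar i)) = const u * xvar i + (const u * xvar i)⁻¹ := by
    rw [zvar, qshift_eq_qshiftHom hu, map_add, ← qshift_eq_qshiftHom, ← qshift_eq_qshiftHom,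
      qshift_mono, qshift_mono, toRat_add, toRat_smul, toRat_smul, toRat_mono_single, mul_inv,
      ← const_inv, xvar]
    simp
  have hprod : ∀ P : Laurent n, toRat (∏ j ∈ Finset.univ.erase i, (P - zvar j)) =
      ∏ j ∈ Finset.univ.erase i, (toRat P - toRat (zvar j)) := fun P => by
    simp only [toRat, map_prod, map_sub]
  rw [hshift, he, hself, ← mul_assoc, ← mul_assoc, toRat_mul (_ * _), toRat_mul (_ * _),
    mul_div_mul_left _ _ hne, hprod, hprod, hzi, ← Finset.prod_div_distrib]
  simp only [toRat_zvar]

lemma cpow_half_mul_self (q : ℂ) : q ^ (1 / 2 : ℂ) * q ^ (1 / 2 : ℂ) = q := by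
  have := Complex.cpow_nat_inv_pow q (n := 2) two_ne_zero
  rw [pow_two] at this
  simpa using this

lemma alpha_typeD {q : ℂ} (hq : q ≠ 0) :
    alpha 1 (-1) (q ^ (1 / 2 : ℂ)) (-q ^ (1 / 2 : ℂ)) q = 1 := by
  have h : 1 * -1 * q ^ (1 / 2 : ℂ) * -q ^ (1 / 2 : ℂ) / q = 1 := by
    rw [div_eq_one_iff_eq hq]
    linear_combination cpow_half_mul_self q
  rw [alpha, h, Complex.one_cpow]

lemma prod_const_erase {n : ℕ} (q : ℂ) (i : Fin n) :
    const (n := n) (q ^ (n - 1)) = ∏ _j ∈ Finset.univ.erase i, const q := by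
  rw [Finset.prod_const, const_pow, Finset.card_erase_of_mem (Finset.mem_univ i), Finset.card_univ,
    Fintype.card_fin]

/-- Both pairs of factors have the shape `(1 - zy)(1 - z/y) = z (z + z⁻¹ - y - y⁻¹)`, with `z = qx`
and `z = x`. The prefactor `q⁻¹` is the share of `t^{1-n}` belonging to one index `j`. -/
lemma plus_factor {K : Type*} [Field K] {q x y : K} (hq : q ≠ 0) (hx : x ≠ 0) (hy : y ≠ 0) :
    q⁻¹ * ((1 - q * x * y) * (1 - q * x / y) / ((1 - x * y) * (1 - x / y))) =
      (q * x + (q * x)⁻¹ - (y + y⁻¹)) / (x + x⁻¹ - (y + y⁻¹)) := by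
  have key : ∀ z : K, z ≠ 0 → (1 - z * y) * (1 - z / y) = z * (z + z⁻¹ - (y + y⁻¹)) := by
    intro z hz
    field_simp
    ring
  rw [key _ hx, key _ (mul_ne_zero hq hx), mul_assoc, mul_div_assoc,
    inv_mul_cancel_left₀ hq, mul_div_mul_left _ _ hx]

lemma minus_factor {K : Type*} [Field K] {q x y : K} (hq : q ≠ 0) (hx : x ≠ 0) (hy : y ≠ 0) :
    q⁻¹ * ((1 - q * y / x) * (1 - q / (x * y)) / ((1 - y / x) * (1 - 1 / (x * y)))) =
      (q⁻¹ * x + (q⁻¹ * x)⁻¹ - (y + y⁻¹)) / (x + x⁻¹ - (y + y⁻¹)) := by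
  have hi : ∀ z : K, z + z⁻¹ = z⁻¹ + z⁻¹⁻¹ := fun z => by rw [inv_inv, add_comm]
  have h := plus_factor hq (inv_ne_zero hx) hy
  rw [hi x, hi (q⁻¹ * x), mul_inv q⁻¹ x, inv_inv q, ← h]
  congr 1
  field_simp

/-- The four parameters pair up to `(1 - x²)(1 - qx²)`, cancelling the denominator, and `q^{1-n}` is
distributed over the `n - 1` factors of the product. -/
lemma koornCoeffPlus_typeD {n : ℕ} {q : ℂ} (hq : q ≠ 0) (i : Fin n) :
    koornCoeffPlus 1 (-1) (q ^ (1 / 2 : ℂ)) (-q ^ (1 / 2 : ℂ)) q q i =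
      toRat (qshift q i (altC (rhoD n))) / toRat (altC (rhoD n)) := by
  have hq' := const_ne_zero (n := n) hq
  have h1 : 1 - xvar i ^ 2 ≠ (0 : RatFun n) := by
    simpa [const_one] using one_sub_const_mul_xvar_sq_ne_zero 1 i
  have h2 := one_sub_const_mul_xvar_sq_ne_zero q i
  have hc : const (q ^ (1 / 2 : ℂ)) * const (q ^ (1 / 2 : ℂ)) = const (n := n) q := by
    rw [← const_mul, cpow_half_mul_self]
  have hnum : (1 - const 1 * xvar i) * (1 - const (-1) * xvar i) *
      (1 - const (q ^ (1 / 2 : ℂ)) * xvar i) * (1 - const (-q ^ (1 / 2 : ℂ)) * xvar i) =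
      (1 - xvar i ^ 2) * (1 - const q * xvar i ^ 2) := by
    rw [const_neg, const_neg, const_one, ← hc]
    ring
  rw [koornCoeffPlus, hnum, alpha_typeD hq, one_mul, mul_assoc (const _),
    div_mul_cancel_right₀ (mul_ne_zero h1 h2), toRat_qshift_altC_div hq, prod_const_erase q i,
    ← Finset.prod_inv_distrib, ← Finset.prod_mul_distrib]
  exact Finset.prod_congr rfl fun j _ => plus_factor hq' (xvar_ne_zero i) (xvar_ne_zero j)

lemma koornCoeffMinus_typeD {n : ℕ} {q : ℂ} (hq : q ≠ 0) (i : Fin n) :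
    koornCoeffMinus 1 (-1) (q ^ (1 / 2 : ℂ)) (-q ^ (1 / 2 : ℂ)) q q i =
      toRat (qshift q⁻¹ i (altC (rhoD n))) / toRat (altC (rhoD n)) := by
  have hq' := const_ne_zero (n := n) hq
  have h1 : 1 - 1 / xvar i ^ 2 ≠ (0 : RatFun n) := by
    simpa [const_one] using one_sub_const_div_xvar_sq_ne_zero 1 i
  have h2 := one_sub_const_div_xvar_sq_ne_zero q i
  have hc : const (q ^ (1 / 2 : ℂ)) * const (q ^ (1 / 2 : ℂ)) = const (n := n) q := by
    rw [← const_mul, cpow_half_mul_self]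
  have hnum : (1 - const 1 / xvar i) * (1 - const (-1) / xvar i) *
      (1 - const (q ^ (1 / 2 : ℂ)) / xvar i) * (1 - const (-q ^ (1 / 2 : ℂ)) / xvar i) =
      (1 - 1 / xvar i ^ 2) * (1 - const q / xvar i ^ 2) := by
    rw [const_neg, const_neg, const_one, ← hc]
    ring
  rw [koornCoeffMinus, hnum, alpha_typeD hq, one_mul, mul_assoc (const _),
    div_mul_cancel_right₀ (mul_ne_zero h1 h2), toRat_qshift_altC_div (inv_ne_zero hq),
    prod_const_erase q i, ← Finset.prod_inv_distrib, ← Finset.prod_mul_distrib]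
  refine Finset.prod_congr rfl fun j _ => ?_
  rw [const_inv]
  exact minus_factor hq' (xvar_ne_zero i) (xvar_ne_zero j)

/-- Conjugation by the Weyl denominator turns Koornwinder's operator into `shiftSum`, up to a
constant. -/
lemma koornOp_typeD {n : ℕ} {q : ℂ} (hq : q ≠ 0) (P : Laurent n) :
    koornOp 1 (-1) (q ^ (1 / 2 : ℂ)) (-q ^ (1 / 2 : ℂ)) q q P * toRat (altC (rhoD n)) =
      toRat (shiftSum q (altC (rhoD n) * P) -
        shiftEigen q (rhoD n) • (altC (rhoD n) * P)) := by
  have hΔ : toRat (altC (rhoD n)) ≠ 0 := by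
    rw [show (0 : RatFun n) = toRat 0 from (map_zero _).symm, toRat_injective.ne_iff]
    exact altC_rhoD_ne_zero n
  have hterm : ∀ u : ℂ, u ≠ 0 → ∀ i : Fin n,
      toRat (qshift u i (altC (rhoD n))) / toRat (altC (rhoD n)) *
        (toRat (qshift u i P) - toRat P) * toRat (altC (rhoD n)) =
      toRat (qshift u i (altC (rhoD n) * P)) - toRat (qshift u i (altC (rhoD n))) * toRat P := by
    intro u hu i
    rw [qshift_eq_qshiftHom hu i (_ * _), map_mul, ← qshift_eq_qshiftHom, ← qshift_eq_qshiftHom,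
      toRat_mul]
    field_simp
  -- Δ is itself an eigenfunction of the shifts, so the terms `-(TΔ)P` add up to the subtracted
  -- scalar multiple of `ΔP`.
  rw [← smul_mul_assoc, ← shiftSum_altC, koornOp, add_mul, Finset.sum_mul, Finset.sum_mul,
    shiftSum, shiftSum, add_mul]
  simp only [koornCoeffPlus_typeD hq, koornCoeffMinus_typeD hq, hterm q hq,
    hterm q⁻¹ (inv_ne_zero hq), toRat_sub, toRat_add, toRat_sum, toRat_mul,
    Finset.sum_sub_distrib, Finset.sum_mul]
  ring

lemma eigenvalueDD_eq {n : ℕ} {q : ℂ} (hq : q ≠ 0) (lam : Fin n → ℤ) :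
    eigenvalueDD q q lam = shiftEigen q (lam + rhoD n) - shiftEigen q (rhoD n) := by
  rw [eigenvalueDD, koornEigenvalue, shiftEigen, shiftEigen, ← Finset.sum_sub_distrib]
  refine Finset.sum_congr rfl fun j _ => ?_
  have h : rhoD n j = ((n - 1 - (j : ℕ) : ℕ) : ℤ) := by
    rw [rhoD]
    omega
  rw [alpha_typeD hq, one_mul, Pi.add_apply, zpow_add₀ hq, h, zpow_natCast]
  ring

/-- After multiplication by the nonzero Δ, the constant `shiftEigen q ρ` appears in both operator
and eigenvalue and cancels, leaving a diagonal eigenvalue problem. -/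
lemma koornOp_eq_iff {n : ℕ} {q : ℂ} (hq : q ≠ 0) (lam : Fin n → ℤ) (P : Laurent n) :
    koornOp 1 (-1) (q ^ (1 / 2 : ℂ)) (-q ^ (1 / 2 : ℂ)) q q P =
        const (koornEigenvalue 1 (-1) (q ^ (1 / 2 : ℂ)) (-q ^ (1 / 2 : ℂ)) q q lam) * toRat P ↔
      shiftSum q (altC (rhoD n) * P) = shiftEigen q (lam + rhoD n) • (altC (rhoD n) * P) := by
  have hΔ : toRat (altC (rhoD n)) ≠ 0 := by
    rw [show (0 : RatFun n) = toRat 0 from (map_zero _).symm, toRat_injective.ne_iff]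
    exact altC_rhoD_ne_zero n
  rw [← mul_left_inj' hΔ, koornOp_typeD hq, ← toRat_smul, ← toRat_mul, toRat_injective.eq_iff,
    sub_eq_iff_eq_add, smul_mul_assoc, mul_comm P, ← add_smul]
  have := eigenvalueDD_eq hq lam
  rw [eigenvalueDD] at this
  rw [this, sub_add_cancel]

/-- The polynomial `s` with `altC ρ * s = altC (λ + ρ)` is the Macdonald polynomial. -/
lemma isMacdonaldDD_of_mul_eq {n : ℕ} {q : ℂ} (hq : q ≠ 0) {lam : Fin n → ℤ} {s : Laurent n}
    (h1 : s - msym lam ∈ lowerSpan lam) (h2 : altC (rhoD n) * s = altC (lam + rhoD n)) :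
    IsMacdonaldDD q q lam s :=
  ⟨h1, (koornOp_eq_iff hq lam s).2 (by rw [h2, shiftSum_altC])⟩

/-- `Δ(P - Q)` is alternating, and its strictly dominant exponents `κ` satisfy `κ - ρ < λ`. A
nonzero coefficient at such a `κ` would force `d_{κ-ρ} = d_λ`. -/
lemma IsMacdonaldDD.unique {n : ℕ} {q : ℂ} (hq : q ≠ 0) {lam : Fin n → ℤ} {P Q : Laurent n}
    (hP : IsMacdonaldDD q q lam P) (hQ : IsMacdonaldDD q q lam Q)
    (hd : ∀ mu : Fin n → ℤ, IsPartition mu → DomLT mu lam →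
      eigenvalueDD q q mu ≠ eigenvalueDD q q lam) : P = Q := by
  have hR : P - Q ∈ lowerSpan lam := by
    rw [← sub_sub_sub_cancel_right P Q (msym lam)]
    exact sub_mem hP.triangular hQ.triangular
  have hLP := (koornOp_eq_iff hq lam P).1 hP.eigen
  have hLQ := (koornOp_eq_iff hq lam Q).1 hQ.eigen
  have hzero : altC (rhoD n) * (P - Q) = 0 := by
    refine (isAlt_altC_mul_lowerSpan hR).eq_zero fun κ hκ => ?_
    by_contra hne
    have hlt : DomLT (κ - rhoD n) lam :=
      domLT_of_coeff_altC_mul hR (by rwa [sub_add_cancel])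
    refine hd _ hκ.sub_rhoD hlt ?_
    rw [eigenvalueDD_eq hq, eigenvalueDD_eq hq, sub_add_cancel]
    congr 1
    refine mul_right_cancel₀ hne ?_
    have h1 := congrArg (fun F : Laurent n => F.coeff κ) hLP
    have h2 := congrArg (fun F : Laurent n => F.coeff κ) hLQ
    simp only [coeff_shiftSum, AddMonoidAlgebra.coeff_smul_apply, smul_eq_mul] at h1 h2
    rw [mul_sub, AddMonoidAlgebra.coeff_sub, Finsupp.sub_apply, mul_sub, mul_sub, h1, h2]
  exact sub_eq_zero.1 ((mul_eq_zero.1 hzero).resolve_left (altC_rhoD_ne_zero n))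

lemma isMacdonaldCC_one_iff {n : ℕ} {q t : ℂ} {lam : Fin n → ℤ} {P : Laurent n} :
    IsMacdonaldCC 1 q t lam P ↔ IsMacdonaldDD q t lam P := by
  rw [IsMacdonaldCC, IsMacdonaldDD, Complex.one_cpow, mul_one]

/-! ### Weyl's character formula of type `D` -/

lemma altSumD_eq {n : ℕ} (κ : Fin n → ℤ) :
    altSumD κ = ∑ σ : Equiv.Perm (Fin n), ((Equiv.Perm.sign σ : ℤˣ) : ℤ) •
      ∑ ε : Fin n → ℤˣ, if ∏ i, ε i = 1 then mono (signedPerm (σ, ε) κ) else 0 := by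
  rw [altSumD, Finset.sum_filter, Fintype.sum_prod_type]
  refine Finset.sum_congr rfl fun σ _ => ?_
  rw [Finset.smul_sum]
  refine Finset.sum_congr rfl fun ε _ => ?_
  split_ifs <;> simp

/-- Toggling the sign at the position sent by `σ` to the last index exchanges even and odd sign
vectors and compensates for `flipLast`. -/
lemma sum_signs_flipLast {n : ℕ} (σ : Equiv.Perm (Fin (n + 1))) (κ : Fin (n + 1) → ℤ) :
    (∑ ε : Fin (n + 1) → ℤˣ,
      if ∏ i, ε i = 1 then mono (signedPerm (σ, ε) (flipLast κ)) else 0) =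
    ∑ ε : Fin (n + 1) → ℤˣ, if ∏ i, ε i = 1 then 0 else mono (signedPerm (σ, ε) κ) := by
  refine Fintype.sum_equiv (Equiv.mulRight (Pi.mulSingle (σ.symm (Fin.last n)) (-1))) _ _ fun ε => ?_
  have hprod : ∏ i, (Equiv.mulRight (Pi.mulSingle (σ.symm (Fin.last n)) (-1)) ε) i =
      -∏ i, ε i := by
    simp [Finset.prod_mul_distrib, Finset.prod_pi_mulSingle']
  have hperm : signedPerm (σ, Equiv.mulRight (Pi.mulSingle (σ.symm (Fin.last n)) (-1)) ε) κ =
      signedPerm (σ, ε) (flipLast κ) := by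
    ext i
    have hi : ((σ i : ℕ) + 1 = n + 1) ↔ i = σ.symm (Fin.last n) := by
      rw [Equiv.eq_symm_apply, Fin.ext_iff, Fin.val_last]
      omega
    simp only [signedPerm, flipLast, Equiv.coe_mulRight, Pi.mul_apply, Units.val_mul, hi]
    by_cases h : i = σ.symm (Fin.last n)
    · rw [if_pos h, h, Pi.mulSingle_eq_same]
      simp
    · rw [if_neg h, Pi.mulSingle_eq_of_ne h]
      simp
  rw [hprod, hperm]
  rcases Int.units_eq_one_or (∏ i, ε i) with h | h <;> simp [h]

/-- A zero entry yields the same monomial for both signs, whereas `cosMono` counts it once; this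
accounts for the powers of 2. -/
lemma sum_signs_mono {n : ℕ} (σ : Equiv.Perm (Fin n)) (κ : Fin n → ℤ) :
    ∑ ε : Fin n → ℤˣ, mono (signedPerm (σ, ε) κ) =
      (∏ a, if κ a = 0 then 2 else 1) * ∏ i, cosMono i (κ (σ i)) := by
  have h1 : ∀ i, ∑ u : ℤˣ, mono (Pi.single i ((u : ℤ) * κ (σ i)) : Fin n → ℤ) =
      (if κ (σ i) = 0 then 2 else 1) * cosMono i (κ (σ i)) := by
    intro i
    rw [show (Finset.univ : Finset ℤˣ) = {1, -1} from rfl, Finset.sum_pair (by decide)]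
    split_ifs with h
    · rw [h, cosMono_zero]
      simp [mono_zero, one_add_one_eq_two]
    · rw [cosMono_of_ne_zero i h]
      simp
  rw [← Equiv.prod_comp σ, ← Finset.prod_mul_distrib, ← Finset.prod_congr rfl fun i _ => h1 i,
    Finset.prod_univ_sum, Fintype.piFinset_univ]
  exact Finset.sum_congr rfl fun ε _ => (prod_mono_single _).symm

lemma altSumD_add_flipLast {n : ℕ} (κ : Fin (n + 1) → ℤ) :
    altSumD κ + altSumD (flipLast κ) = (∏ a, if κ a = 0 then 2 else 1) * altC κ := by
  rw [altSumD_eq, altSumD_eq, ← Finset.sum_add_distrib, altC, Matrix.det_apply, Finset.mul_sum]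
  refine Finset.sum_congr rfl fun σ _ => ?_
  rw [sum_signs_flipLast, ← smul_add, ← Finset.sum_add_distrib, Units.smul_def, mul_smul_comm]
  congr 1
  simp only [Matrix.of_apply]
  rw [← sum_signs_mono]
  refine Finset.sum_congr rfl fun ε _ => ?_
  split_ifs <;> simp

lemma IsStrict.ne_zero {n : ℕ} {κ : Fin (n + 1) → ℤ} (h : IsStrict κ) {a : Fin (n + 1)}
    (ha : a ≠ Fin.last n) : κ a ≠ 0 := by
  have h1 := h.1 (lt_of_le_of_ne (Fin.le_last a) ha)
  have h2 := h.2 (Fin.last n)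
  omega

lemma altSumD_add_flipLast_of_ne_zero {n : ℕ} {κ : Fin (n + 1) → ℤ} (h : IsStrict κ)
    (h0 : κ (Fin.last n) ≠ 0) : altSumD κ + altSumD (flipLast κ) = altC κ := by
  rw [altSumD_add_flipLast, Finset.prod_eq_one, one_mul]
  intro a _
  refine if_neg ?_
  rcases eq_or_ne a (Fin.last n) with rfl | ha
  · exact h0
  · exact h.ne_zero ha

lemma flipLast_eq_self {n : ℕ} {κ : Fin (n + 1) → ℤ} (h0 : κ (Fin.last n) = 0) :
    flipLast κ = κ := by
  ext i
  rw [flipLast]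
  split_ifs with h
  · rw [show i = Fin.last n from Fin.ext (by rw [Fin.val_last]; omega), h0, neg_zero]
  · rfl

/-- Here `flipLast` acts trivially, so the left side of `altSumD_add_flipLast` is doubled; the one
zero entry doubles the right side too. -/
lemma altSumD_of_eq_zero {n : ℕ} {κ : Fin (n + 1) → ℤ} (h : IsStrict κ)
    (h0 : κ (Fin.last n) = 0) : altSumD κ = altC κ := by
  have h1 := altSumD_add_flipLast κ
  rw [flipLast_eq_self h0, Finset.prod_eq_single (Fin.last n)
    (fun a _ ha => if_neg (h.ne_zero ha)) (by simp), if_pos h0, two_mul,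
    ← two_smul ℂ, ← two_smul ℂ] at h1
  exact smul_right_injective _ (two_ne_zero' ℂ) h1

lemma flipLast_add_rhoD {n : ℕ} (lam : Fin (n + 1) → ℤ) :
    flipLast lam + rhoD (n + 1) = flipLast (lam + rhoD (n + 1)) := by
  ext i
  simp only [flipLast, Pi.add_apply, rhoD]
  split_ifs with h
  · omega
  · rfl

/-- Since `ρ` ends in 0, the type D denominator is Δ. The numerator is `altC (λ + ρ)` directly when
`λ_n = 0`, and is the sum of two type D numerators when `λ_n > 0`. -/
lemma schurD_eq_of_mul_eq {n : ℕ} (hn : 0 < n) {lam : Fin n → ℤ} (hlam : IsPartition lam)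
    {s : Laurent n} (hs : altC (rhoD n) * s = altC (lam + rhoD n)) :
    schurD lam = toRat s := by
  obtain ⟨n, rfl⟩ := Nat.exists_eq_succ_of_ne_zero hn.ne'
  have hρ : rhoD (n + 1) (Fin.last n) = 0 := by
    simp [rhoD]
  have hΔ : toRat (altC (rhoD (n + 1))) ≠ 0 := by
    rw [show (0 : RatFun (n + 1)) = toRat 0 from (map_zero _).symm, toRat_injective.ne_iff]
    exact altC_rhoD_ne_zero (n + 1)
  have hlast : (lam + rhoD (n + 1)) (Fin.last n) = lam (Fin.last n) := by
    rw [Pi.add_apply, hρ, add_zero]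
  rw [schurD, charD, charD, altSumD_of_eq_zero (isStrict_rhoD _) hρ, flipLast_add_rhoD]
  split_ifs with h
  · rw [← add_div, ← toRat_add, altSumD_add_flipLast_of_ne_zero hlam.add_rhoD
      (by rw [hlast]; exact h _), div_eq_iff hΔ, ← toRat_mul, mul_comm, hs]
  · have h0 : lam (Fin.last n) = 0 := by
      push Not at h
      obtain ⟨i, hi⟩ := h
      exact le_antisymm (hi ▸ hlam.1 (Fin.le_last i)) (hlam.2 _)
    rw [altSumD_of_eq_zero hlam.add_rhoD (by rw [hlast, h0]), div_eq_iff hΔ, ← toRat_mul,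
      mul_comm, hs]

/-! ### The polynomials `E_r` in terms of the monomial symmetric polynomials -/

/-- The number of nonzero entries. -/
def numNonzero {n : ℕ} (ν : Fin n → ℤ) : ℕ := (Finset.univ.filter fun i => ν i ≠ 0).card

lemma numNonzero_le {n : ℕ} (ν : Fin n → ℤ) : numNonzero ν ≤ n :=
  (Finset.card_le_univ _).trans_eq (Fintype.card_fin n)

lemma card_filter_val_lt {n s : ℕ} (hs : s ≤ n) :
    (Finset.univ.filter fun i : Fin n => (i : ℕ) < s).card = s := by
  rw [Fin.card_filter_val_lt, min_eq_right hs]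

lemma mem_orbit_col {n s : ℕ} (hs : s ≤ n) {ν : Fin n → ℤ} :
    ν ∈ orbit (col n s) ↔ (∀ i, |ν i| ≤ 1) ∧ numNonzero ν = s := by
  rw [mem_orbit]
  constructor
  · rintro ⟨σ, hσ⟩
    have hcol : ∀ i, |ν i| = if (σ i : ℕ) < s then 1 else 0 := fun i => by
      rw [hσ, col]
      split_ifs <;> simp
    refine ⟨fun i => ?_, ?_⟩
    · rw [hcol]
      split_ifs <;> simp
    · rw [← card_filter_val_lt hs, numNonzero]
      refine Finset.card_equiv σ fun i => ?_
      have := hcol i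
      simp only [Finset.mem_filter, Finset.mem_univ, true_and]
      rw [← abs_ne_zero, this]
      split_ifs with h <;> simp [h]
  · rintro ⟨h1, h2⟩
    have hcard : Fintype.card {i // ν i ≠ 0} = Fintype.card {i : Fin n // (i : ℕ) < s} := by
      rw [Fintype.card_subtype, Fintype.card_subtype, card_filter_val_lt hs]
      exact h2
    -- A bijection from the support of `ν` to the first `s` indices, extended to a permutation.
    set e := Fintype.equivOfCardEq hcard
    refine ⟨e.extendSubtype, fun i => ?_⟩
    rw [col]
    by_cases hi : ν i = 0
    · rw [if_neg (e.extendSubtype_not_mem i (not_not.2 hi)), hi]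
    · rw [if_pos (e.extendSubtype_mem i hi), abs_one]
      have := h1 i
      have := abs_pos.2 hi
      omega

open Polynomial in
-- Each factor is `(1 + y²) - y (x_i + x_i⁻¹)`, so expanding the product chooses an exponent in
-- `{-1, 0, 1}` for every variable.
lemma genE_eq {n : ℕ} : genE n = ∑ p ∈ Fintype.piFinset fun _ : Fin n => ({-1, 0, 1} : Finset ℤ),
    C (mono p) * ((-X) ^ numNonzero p * (1 + X ^ 2) ^ (n - numNonzero p)) := by
  have hfac : ∀ i : Fin n, (1 - X * C (mono (Pi.single i 1))) *
      (1 - X * C (mono (Pi.single i (-1)))) =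
      ∑ e ∈ ({-1, 0, 1} : Finset ℤ), C (mono (Pi.single i e : Fin n → ℤ)) *
        if e ≠ 0 then -X else 1 + X ^ 2 := by
    intro i
    have h : C (mono (Pi.single i 1 : Fin n → ℤ)) * C (mono (Pi.single i (-1))) = 1 := by
      rw [← C_mul, mono_single_mul_neg, C_1]
    rw [Finset.sum_insert (by decide), Finset.sum_pair (by decide)]
    simp only [Pi.single_zero, mono_zero, C_1]
    norm_num
    linear_combination X ^ 2 * h
  rw [genE, Finset.prod_congr rfl fun i _ => hfac i, Finset.prod_univ_sum]
  refine Finset.sum_congr rfl fun p _ => ?_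
  rw [Finset.prod_mul_distrib, ← map_prod, prod_mono_single, Finset.prod_ite, Finset.prod_const,
    Finset.prod_const, numNonzero]
  congr 3
  have := Finset.card_filter_add_card_filter_not (s := Finset.univ) fun i : Fin n => p i ≠ 0
  rw [Finset.card_univ, Fintype.card_fin] at this
  omega

open Polynomial in
lemma coeff_neg_X_pow_mul {R : Type*} [CommRing R] (k m r : ℕ) :
    ((-X : R[X]) ^ k * (1 + X ^ 2) ^ m).coeff r =
      if k ≤ r ∧ Even (r - k) then (-1) ^ r * (m.choose ((r - k) / 2) : R) else 0 := by
  have hexp : ((1 : R[X]) + X ^ 2) ^ m = expand R 2 ((1 + X) ^ m) := by simp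
  rw [neg_pow, mul_assoc, ← C_1, ← C_neg, ← C_pow, coeff_C_mul, coeff_X_pow_mul', C_1, hexp]
  by_cases hk : k ≤ r
  · rw [if_pos hk, coeff_expand two_pos]
    simp only [hk, true_and, even_iff_two_dvd]
    split_ifs with h
    · rw [coeff_one_add_X_pow]
      congr 1
      obtain ⟨l, hl⟩ := h
      rw [show r = k + 2 * l by omega, pow_add, pow_mul]
      simp
    · rw [mul_zero]
  · rw [if_neg hk, if_neg fun h => hk h.1, mul_zero]

lemma coeff_Epoly (n r : ℕ) (ν : Fin n → ℤ) : (Epoly n r).coeff ν =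
    if (∀ i, |ν i| ≤ 1) ∧ numNonzero ν ≤ r ∧ Even (r - numNonzero ν) then
      ((n - numNonzero ν).choose ((r - numNonzero ν) / 2) : ℂ) else 0 := by
  have hE : Epoly n r = ∑ p ∈ Fintype.piFinset fun _ : Fin n => ({-1, 0, 1} : Finset ℤ),
      (if numNonzero p ≤ r ∧ Even (r - numNonzero p) then
        ((n - numNonzero p).choose ((r - numNonzero p) / 2) : ℂ) else 0) • mono p := by
    rw [Epoly, genE_eq, Polynomial.finsetSum_coeff, Finset.mul_sum]
    refine Finset.sum_congr rfl fun p _ => ?_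
    rw [Polynomial.coeff_C_mul, coeff_neg_X_pow_mul]
    split_ifs
    · rw [mul_left_comm, ← mul_assoc ((-1) ^ r), ← pow_add, ← two_mul, pow_mul, neg_one_sq,
        one_pow, one_mul, Algebra.smul_def, map_natCast, mul_comm]
    · simp
  rw [hE, AddMonoidAlgebra.coeff_sum, Finsupp.finsetSum_apply]
  simp only [AddMonoidAlgebra.coeff_smul_apply, coeff_mono, smul_eq_mul, mul_ite, mul_one, mul_zero,
    Finset.sum_ite_eq']
  have hmem : ν ∈ (Fintype.piFinset fun _ : Fin n => ({-1, 0, 1} : Finset ℤ)) ↔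
      ∀ i, |ν i| ≤ 1 := by
    simp only [Fintype.mem_piFinset, Finset.mem_insert, Finset.mem_singleton, abs_le]
    exact forall_congr' fun i => by omega
  simp only [hmem, ite_and]

lemma Epoly_eq_sum_msym {n r : ℕ} (hr : r ≤ n) : Epoly n r =
    ∑ k ∈ Finset.range (r / 2 + 1),
      Nat.choose (n - r + 2 * k) k • msym (col n (r - 2 * k)) := by
  rw [← AddMonoidAlgebra.coeff_inj]
  ext ν
  rw [coeff_Epoly, AddMonoidAlgebra.coeff_sum, Finsupp.finsetSum_apply]
  have hterm : ∀ k ∈ Finset.range (r / 2 + 1),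
      (Nat.choose (n - r + 2 * k) k • msym (col n (r - 2 * k))).coeff ν =
      if (∀ i, |ν i| ≤ 1) ∧ numNonzero ν = r - 2 * k then
        (Nat.choose (n - r + 2 * k) k : ℂ) else 0 := by
    intro k _
    rw [AddMonoidAlgebra.coeff_smul_apply, coeff_msym]
    simp only [mem_orbit_col ((Nat.sub_le _ _).trans hr), nsmul_eq_mul, mul_ite, mul_one, mul_zero]
  rw [Finset.sum_congr rfl hterm]
  split_ifs with h
  · obtain ⟨h1, h2, l, hl⟩ := h
    rw [Finset.sum_eq_single l]
    · rw [if_pos ⟨h1, by omega⟩, show n - numNonzero ν = n - r + 2 * l by omega,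
        show (r - numNonzero ν) / 2 = l by omega]
    · intro k hk hkl
      refine if_neg fun h => hkl ?_
      have := Finset.mem_range.1 hk
      omega
    · intro hl'
      exact absurd (Finset.mem_range.2 (by omega)) hl'
  · symm
    refine Finset.sum_eq_zero fun k hk => if_neg fun h' => h ⟨h'.1, by omega, ?_⟩
    have := Finset.mem_range.1 hk
    exact ⟨k, by omega⟩

/-! ### The one-column Schur polynomials -/

open Polynomial in
-- Each quadratic factor is palindromic, and reflection is multiplicative once degree bounds are
-- fixed.
lemma reflect_genE (n : ℕ) : reflect (2 * n) (genE n) = genE n := by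
  have key : ∀ s : Finset (Fin n), (∏ i ∈ s, (1 - X * C (mono (Pi.single i 1 : Fin n → ℤ))) *
      (1 - X * C (mono (Pi.single i (-1))))).natDegree ≤ 2 * s.card ∧
      reflect (2 * s.card) (∏ i ∈ s, (1 - X * C (mono (Pi.single i 1 : Fin n → ℤ))) *
      (1 - X * C (mono (Pi.single i (-1))))) =
      ∏ i ∈ s, (1 - X * C (mono (Pi.single i 1 : Fin n → ℤ))) *
      (1 - X * C (mono (Pi.single i (-1)))) := by
    intro s
    induction s using Finset.induction_on with
    | empty => simp
    | insert i s hi ih =>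
      have hfac : (1 - X * C (mono (Pi.single i 1 : Fin n → ℤ))) *
          (1 - X * C (mono (Pi.single i (-1)))) =
          C 1 * X ^ 0 + C (-zvar i) * X ^ 1 + C 1 * X ^ 2 := by
        have h : C (mono (Pi.single i 1 : Fin n → ℤ)) * C (mono (Pi.single i (-1))) = 1 := by
          rw [← C_mul, mono_single_mul_neg, C_1]
        rw [zvar, C_neg, C_add, C_1]
        linear_combination X ^ 2 * h
      have hdeg : (C 1 * X ^ 0 + C (-zvar i) * X ^ 1 + C 1 * X ^ 2 : (Laurent n)[X]).natDegree ≤ 2 := by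
        compute_degree
      have hrefl : reflect 2 (C 1 * X ^ 0 + C (-zvar i) * X ^ 1 + C 1 * X ^ 2 : (Laurent n)[X]) =
          C 1 * X ^ 0 + C (-zvar i) * X ^ 1 + C 1 * X ^ 2 := by
        rw [reflect_add, reflect_add, reflect_C_mul_X_pow, reflect_C_mul_X_pow,
          reflect_C_mul_X_pow, revAt_le (by omega), revAt_le (by omega), revAt_le (by omega)]
        ring
      rw [Finset.prod_insert hi, Finset.card_insert_of_notMem hi, hfac, mul_add, mul_one,
        add_comm (2 * s.card)]
      refine ⟨natDegree_mul_le.trans (by omega), ?_⟩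
      rw [reflect_mul _ _ hdeg ih.1, ih.2, hrefl]
  simpa [genE] using (key Finset.univ).2

open Polynomial in
lemma natDegree_genE_le (n : ℕ) : (genE n).natDegree ≤ 2 * n := by
  rw [genE]
  refine (natDegree_prod_le _ _).trans ((Finset.sum_le_card_nsmul _ _ 2 fun i _ => ?_).trans
    (by simp [mul_comm]))
  compute_degree

lemma coeff_genE_sub {n r : ℕ} (hr : r ≤ 2 * n) : (genE n).coeff (2 * n - r) = (genE n).coeff r := by
  rw [← Polynomial.revAt_le hr, ← Polynomial.coeff_reflect, reflect_genE]

lemma sum_range_two_mul_add_one {M : Type*} [AddCommMonoid M] (f : ℕ → M) (n : ℕ) :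
    ∑ r ∈ Finset.range (2 * n + 1), f r = ∑ r ∈ Finset.range n, (f r + f (2 * n - r)) + f n := by
  rw [two_mul, add_assoc, Finset.sum_range_add, ← Finset.sum_range_reflect fun x => f (n + x),
    Finset.sum_range_succ, Finset.sum_add_distrib, add_assoc]
  congr 2
  · refine Finset.sum_congr rfl fun r hr => ?_
    have := Finset.mem_range.1 hr
    congr 1
    omega
  · congr 1
    omega

/-- `y = x_j⁻¹` is a root of `genE`. Multiplying by `x_j^n` and pairing `r` with `2n - r` by the
palindromic symmetry gives the sum; the middle term occurs once, matching `cosMono j 0 = 1`. -/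
lemma sum_coeff_genE_mul_cosMono {n : ℕ} (j : Fin n) :
    ∑ r ∈ Finset.range (n + 1), (genE n).coeff r * cosMono j ((n : ℤ) - r) = 0 := by
  have hroot : (genE n).eval (mono (Pi.single j (-1))) = 0 := by
    rw [genE, Polynomial.eval_prod]
    refine Finset.prod_eq_zero (Finset.mem_univ j) ?_
    have h := mono_single_mul_neg j 1
    simp only [Polynomial.eval_mul, Polynomial.eval_sub, Polynomial.eval_one, Polynomial.eval_X,
      Polynomial.eval_C]
    rw [mul_comm (mono _), h, sub_self, zero_mul]
  rw [Polynomial.eval_eq_sum_range' (Nat.lt_succ_of_le (natDegree_genE_le n)), Nat.succ_eq_add_one,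
    sum_range_two_mul_add_one] at hroot
  have h2 := congrArg (fun P => P * mono (Pi.single j (n : ℤ))) hroot
  simp only [zero_mul, add_mul, Finset.sum_mul] at h2
  rw [Finset.sum_range_succ, sub_self, cosMono_zero, ← h2]
  congr 1
  · refine Finset.sum_congr rfl fun r hr => ?_
    have hr' := Finset.mem_range.1 hr
    rw [coeff_genE_sub (by omega), cosMono_of_ne_zero j (by omega), mul_assoc, mul_assoc, ← mul_add,
      mono_single_pow, mono_single_pow, ← mono_add, ← mono_add, ← Pi.single_add, ← Pi.single_add]
    congr 4
    · ring
    · push_cast [show r ≤ 2 * n by omega]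
      ring
  · rw [mono_single_pow, mul_assoc, ← mono_add, ← Pi.single_add]
    simp [mono_zero]

lemma coeff_genE_zero (n : ℕ) : (genE n).coeff 0 = 1 := by
  rw [Polynomial.coeff_zero_eq_eval_zero, genE, Polynomial.eval_prod]
  simp

lemma cosMono_natCast_eq {n : ℕ} (j : Fin n) :
    cosMono j (n : ℤ) = ∑ a : Fin n, -(genE n).coeff (a + 1) * cosMono j (rhoD n a) := by
  have h := sum_coeff_genE_mul_cosMono j
  rw [Finset.sum_range_succ', coeff_genE_zero, one_mul, Nat.cast_zero, sub_zero, add_comm] at h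
  rw [eq_neg_of_add_eq_zero_left h, Finset.sum_range, ← Finset.sum_neg_distrib]
  refine Finset.sum_congr rfl fun a _ => ?_
  rw [neg_mul, rhoD]
  push_cast
  ring_nf

/-- Replacing row `r` (counted from 0) of Δ by the row of exponent `n` multiplies the determinant by
minus the coefficient of `y^{r+1}`, by `cosMono_natCast_eq`, whose coefficients do not depend on
`j`. Up to a cyclic permutation of rows, the new matrix is that of `(1^{r+1}) + ρ`. -/
lemma altC_rhoD_mul_Epoly {n r : ℕ} (hr : r ≤ n) :
    altC (rhoD n) * Epoly n r = altC (col n r + rhoD n) := by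
  cases r with
  | zero =>
    have : col n 0 = 0 := by
      ext
      simp [col]
    rw [this, zero_add, Epoly, coeff_genE_zero, pow_zero, mul_one, mul_one]
  | succ r =>
    set b : Fin n := ⟨r, hr⟩ with hb
    set Q : Matrix (Fin n) (Fin n) (Laurent n) := Matrix.of fun a i => cosMono i (rhoD n a) with hQ
    have hcramer := Matrix.det_updateRow_sum Q b
      fun a : Fin n => -(genE n).coeff (a + 1)
    have hmat : Q.updateRow b (∑ a : Fin n, -(genE n).coeff (a + 1) • Q a) =
        (Matrix.of fun a i => cosMono i ((col n (r + 1) + rhoD n) a)).submatrix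
          (Fin.cycleRange b) id := by
      ext1 a i
      rw [Matrix.submatrix_apply, Matrix.of_apply, id]
      rcases lt_trichotomy a b with h | h | h
      · rw [Matrix.updateRow_ne h.ne, hQ, Matrix.of_apply, Pi.add_apply, col, rhoD, rhoD,
          Fin.coe_cycleRange_of_lt h, if_pos (by have : (a : ℕ) < r := h; omega)]
        push_cast
        ring_nf
      · subst h
        have h0 : ((Fin.cycleRange b b : Fin n) : ℕ) = 0 := by
          rw [Fin.coe_cycleRange_of_le le_rfl, if_pos rfl]
        rw [Matrix.updateRow_self, Pi.add_apply, col, rhoD, h0, if_pos (Nat.succ_pos r)]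
        simp only [Finset.sum_apply, Pi.smul_apply, smul_eq_mul, hQ, Matrix.of_apply]
        rw [← cosMono_natCast_eq]
        push_cast
        ring_nf
      · rw [Matrix.updateRow_ne h.ne', hQ, Matrix.of_apply, Pi.add_apply, Fin.cycleRange_of_gt h, col,
          if_neg (by have : r < (a : ℕ) := h; omega), zero_add]
    -- The cycle on the first `r + 1` rows has sign `(-1)^r`, which with the minus sign above gives
    -- the `(-1)^{r+1}` of `Epoly`.
    rw [hmat, Matrix.det_permute, Fin.sign_cycleRange] at hcramer
    rw [Epoly, altC, altC, ← hQ]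
    have hsq : ((-1 : Laurent n) ^ r) * (-1) ^ r = 1 := by
      rw [← mul_pow]
      simp
    simp only [hb, smul_eq_mul] at hcramer
    push_cast at hcramer
    rw [pow_succ]
    linear_combination (-(-1) ^ r) * hcramer +
      (Matrix.of fun a i => cosMono i ((col n (r + 1) + rhoD n) a)).det * hsq

/-! ### The deformed Catalan triangle -/

lemma cpow_half_sq (q : ℂ) : (q ^ (1 / 2 : ℂ)) ^ 2 = q := by
  rw [pow_two, cpow_half_mul_self]

lemma one_sub_one_div_pow_ne_zero {q : ℂ} (hq0 : q ≠ 0) (hq1 : ‖q‖ < 1) {k : ℕ} (hk : k ≠ 0) :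
    1 - 1 / q ^ k ≠ 0 := by
  intro h
  have h1 : q ^ k = 1 := by
    have := pow_ne_zero k hq0
    field_simp at h
    linear_combination h
  have h2 := pow_lt_one₀ (norm_nonneg q) hq1 hk
  rw [← norm_pow, h1, norm_one] at h2
  exact lt_irrefl _ h2

/-- At `s = t` the factor `1 - t/(a²c²)` occurs in numerator and denominator and vanishes at the
point; after cancelling it the function is continuous there. -/
lemma fHasValueAt_zero {q : ℂ} (hq0 : q ≠ 0) (hq1 : ‖q‖ < 1) :
    FHasValueAt 0 (1, q ^ (1 / 2 : ℂ), q) 2 := by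
  have hc : q ^ (1 / 2 : ℂ) ≠ 0 := fun h => hq0 (by rw [← cpow_half_sq q, h]; simp)
  have hq2 := one_sub_one_div_pow_ne_zero hq0 hq1 two_ne_zero
  constructor
  -- Moving `a` off 1 with `c` and `t` fixed shows that the point is a limit of admissible
  -- parameters.
  · have hcont : Tendsto (fun e : ℂ => ((1 + e, q ^ (1 / 2 : ℂ), q) : ℂ × ℂ × ℂ)) (𝓝[≠] 0)
        (𝓝 (1, q ^ (1 / 2 : ℂ), q)) := by
      have : Continuous fun e : ℂ => ((1 + e, q ^ (1 / 2 : ℂ), q) : ℂ × ℂ × ℂ) := by fun_prop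
      simpa using (this.tendsto 0).mono_left nhdsWithin_le_nhds
    refine Tendsto.neBot (f := fun e : ℂ => ((1 + e, q ^ (1 / 2 : ℂ), q) : ℂ × ℂ × ℂ))
      (x := 𝓝[≠] 0) (tendsto_nhdsWithin_iff.2 ⟨hcont, ?_⟩)
    have h1 : ∀ᶠ e : ℂ in 𝓝 0, 1 + e ≠ 0 :=
      (by fun_prop : ContinuousAt (fun e : ℂ => 1 + e) 0).eventually_ne (by simp)
    have h2 : ∀ᶠ e : ℂ in 𝓝 0, 2 + e ≠ 0 :=
      (by fun_prop : ContinuousAt (fun e : ℂ => 2 + e) 0).eventually_ne (by simp)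
    have h3 : ∀ᶠ e : ℂ in 𝓝 0, 1 - 1 / ((1 + e) ^ 2 * q ^ 2) ≠ 0 := by
      refine ContinuousAt.eventually_ne ?_ (by simpa using hq2)
      refine continuousAt_const.sub (continuousAt_const.div (by fun_prop) ?_)
      simpa using hq0
    filter_upwards [nhdsWithin_le_nhds h1, nhdsWithin_le_nhds h2, nhdsWithin_le_nhds h3,
      self_mem_nhdsWithin] with e he1 he2 he3 he0
    refine ⟨he1, hc, hq0, ?_⟩
    rw [fDen, cpow_half_sq, zero_add, pow_one]
    refine mul_ne_zero ?_ ?_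
    · convert he3 using 2
      field_simp
    · intro h
      have he0' : e ≠ 0 := he0
      have h' : e * (2 + e) = 0 := by
        field_simp at h
        linear_combination h
      exact (mul_ne_zero he0' he2) h'
  · set g : ℂ × ℂ × ℂ → ℂ := fun z => (1 - 1 / z.2.2) * (1 + 1 / z.1 ^ 2) * (1 + 1 / z.2.1 ^ 2) /
      (1 - 1 / (z.2.2 * z.1 ^ 2 * z.2.1 ^ 2)) with hg
    have hden : q * 1 ^ 2 * (q ^ (1 / 2 : ℂ)) ^ 2 = q ^ 2 := by
      rw [cpow_half_sq]
      ring
    have hval : g (1, q ^ (1 / 2 : ℂ), q) = 2 := by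
      simp only [hg]
      rw [hden, cpow_half_sq, div_eq_iff hq2]
      field_simp
      ring
    have hcont : ContinuousAt g (1, q ^ (1 / 2 : ℂ), q) := by
      refine ContinuousAt.div (((continuousAt_const.sub (continuousAt_const.div (by fun_prop) hq0)).mul
        (continuousAt_const.add (continuousAt_const.div (by fun_prop) (by simp)))).mul
        (continuousAt_const.add (continuousAt_const.div (by fun_prop) (pow_ne_zero 2 hc))))
        (continuousAt_const.sub (continuousAt_const.div (by fun_prop) ?_)) ?_
      · simp only [hden]
        exact pow_ne_zero 2 hq0
      · simp only [hden]
        exact hq2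
    have hlim := hcont.tendsto
    rw [hval] at hlim
    refine (hlim.mono_left nhdsWithin_le_nhds).congr' ?_
    filter_upwards [self_mem_nhdsWithin] with z hz
    obtain ⟨ha, hc, ht, hd⟩ := hz
    rw [fDen, zero_add, pow_one, mul_ne_zero_iff] at hd
    obtain ⟨a, c, t⟩ := z
    simp only at ha hc ht hd
    have e1 : 1 - t / (t ^ 2 * a ^ 2 * c ^ 2) = 1 - 1 / (t * a ^ 2 * c ^ 2) := by
      field_simp
    have e2 : 1 - t ^ 3 / (t ^ 2 * a ^ 2 * c ^ 2) = 1 - t ^ 2 / (t * a ^ 2 * c ^ 2) := by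
      field_simp
    have e3 : t / (t * a ^ 2) = 1 / a ^ 2 := by field_simp
    have e4 : t / (t * c ^ 2) = 1 / c ^ 2 := by field_simp
    simp only [hg, f, fDen, zero_add, pow_one]
    rw [e1, e2] at hd ⊢
    rw [e3, e4]
    refine (mul_div_mul_right _ _ hd.2).symm.trans ?_
    congr 1
    ring

/-- With `s = q^{i+1}`, numerator and denominator both equal `(1 - 1/s²)(1 - q²/s²)`, nonzero for `i
> 0`, so the limit is the value at the point. -/
lemma fHasValueAt_pos {q : ℂ} (hq0 : q ≠ 0) (hq1 : ‖q‖ < 1) {i : ℕ} (hi : 0 < i) :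
    FHasValueAt i (1, q ^ (1 / 2 : ℂ), q) 1 := by
  have hc : q ^ (1 / 2 : ℂ) ≠ 0 := fun h => hq0 (by rw [← cpow_half_sq q, h]; simp)
  obtain ⟨k, rfl⟩ := Nat.exists_eq_succ_of_ne_zero hi.ne'
  have hA := one_sub_one_div_pow_ne_zero hq0 hq1 (k := 2 * k + 4) (by omega)
  have hB := one_sub_one_div_pow_ne_zero hq0 hq1 (k := 2 * k + 2) (by omega)
  have h1 : q / ((q ^ (k + 1 + 1)) ^ 2 * 1 ^ 2 * q) = 1 / q ^ (2 * k + 4) := by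
    field_simp
    ring
  have h2 : q ^ 3 / ((q ^ (k + 1 + 1)) ^ 2 * 1 ^ 2 * q) = 1 / q ^ (2 * k + 2) := by
    field_simp
    ring
  have hden : fDen 1 (q ^ (1 / 2 : ℂ)) q (q ^ (k + 1 + 1)) ≠ 0 := by
    rw [fDen, cpow_half_sq, h1, h2]
    exact mul_ne_zero hA hB
  have hval : f 1 (q ^ (1 / 2 : ℂ)) q (q ^ (k + 1 + 1)) = 1 := by
    rw [f, div_eq_one_iff_eq hden, fDen, cpow_half_sq, h1, h2]
    have hk := pow_ne_zero k hq0
    field_simp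
    ring
  have hs := pow_ne_zero (k + 1 + 1) hq0
  refine ⟨mem_closure_iff_nhdsWithin_neBot.1 (subset_closure ⟨one_ne_zero, hc, hq0, hden⟩), ?_⟩
  suffices hcont : ContinuousAt (fun z : ℂ × ℂ × ℂ => f z.1 z.2.1 z.2.2 (z.2.2 ^ (k + 1 + 1)))
      (1, q ^ (1 / 2 : ℂ), q) by
    have hlim := hcont.tendsto
    simp only [hval] at hlim
    exact hlim.mono_left nhdsWithin_le_nhds
  have hp : ∀ d : ℂ → ℂ → ℂ → ℂ, d 1 (q ^ (1 / 2 : ℂ)) (q ^ (k + 1 + 1)) ≠ 0 →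
      ContinuousAt (fun z : ℂ × ℂ × ℂ => d z.1 z.2.1 (z.2.2 ^ (k + 1 + 1)))
        (1, q ^ (1 / 2 : ℂ), q) → ∀ m : ℕ,
      ContinuousAt (fun z : ℂ × ℂ × ℂ => z.2.2 ^ m / d z.1 z.2.1 (z.2.2 ^ (k + 1 + 1)))
        (1, q ^ (1 / 2 : ℂ), q) :=
    fun d hd hcd m => ContinuousAt.div (by fun_prop) hcd hd
  have c0 := hp (fun _ _ s => s) hs (by fun_prop) 0
  have c1 := hp (fun a c s => s * a ^ 2 * c ^ 2) (by simp [hq0]) (by fun_prop) 2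
  have c2 := hp (fun a _ s => s * a ^ 2) (by simp [hq0]) (by fun_prop) 1
  have c3 := hp (fun _ c s => s * c ^ 2) (by simp [hq0]) (by fun_prop) 1
  have c4 := hp (fun a c s => s ^ 2 * a ^ 2 * c ^ 2) (by simp [hq0]) (by fun_prop)
  have c5 := c4 1
  simp only [pow_zero, pow_one] at c0 c2 c3 c5
  exact ((((continuousAt_const.sub c0).mul (continuousAt_const.sub c1)).mul
    (continuousAt_const.add c2)).mul (continuousAt_const.add c3)).div
    ((continuousAt_const.sub c5).mul (continuousAt_const.sub (c4 3))) hden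

/-- The half of Pascal's triangle. -/
def pascalHalf (i j : ℕ) : ℂ :=
  if i ≤ j ∧ Even (i + j) then ((Nat.choose j ((j - i) / 2) : ℕ) : ℂ) else 0

lemma pascalHalf_add (i k : ℕ) : pascalHalf i (i + 2 * k) = ((i + 2 * k).choose k : ℂ) := by
  rw [pascalHalf, if_pos ⟨by omega, ⟨i + k, by omega⟩⟩, show (i + 2 * k - i) / 2 = k by omega]

/-- Interior steps are Pascal's rule. In the first row the factor 2 comes from the symmetry `C(2k+1,
k) = C(2k+1, k+1)`. -/
lemma isDeformedCatalanTriangle_pascalHalf :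
    IsDeformedCatalanTriangle (fun i => if i = 0 then 2 else 1) pascalHalf where
  upper i j h := if_neg fun hh => by omega
  even i j h := if_neg fun hh => (Nat.not_even_iff_odd.2 h) hh.2
  zero_zero := by simpa using pascalHalf_add 0 0
  diag i _ := by
    have h1 := pascalHalf_add (i - 1) 0
    have h2 := pascalHalf_add i 0
    simp only [mul_zero, add_zero, Nat.choose_zero_right] at h1 h2
    rw [h1, h2]
  first_row j hj he := by
    obtain ⟨k, hk⟩ := he
    obtain ⟨k, rfl⟩ := Nat.exists_eq_succ_of_ne_zero (by omega : k ≠ 0)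
    have h1 := pascalHalf_add 1 k
    have h2 := pascalHalf_add 0 (k + 1)
    rw [show j - 1 = 1 + 2 * k by omega, show j = 0 + 2 * (k + 1) by omega, h1, h2, if_pos rfl]
    have h3 : (0 + 2 * (k + 1)).choose (k + 1) = 2 * (1 + 2 * k).choose k := by
      rw [show 0 + 2 * (k + 1) = (2 * k + 1) + 1 by ring, Nat.choose_succ_succ,
        Nat.choose_symm_half, add_comm 1]
      ring
    rw [h3]
    push_cast
    ring
  step i j he hi hij := by
    obtain ⟨m, hm⟩ := he
    obtain ⟨i, rfl⟩ := Nat.exists_eq_succ_of_ne_zero hi.ne'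
    obtain ⟨k, hk⟩ : ∃ k, j = i + 1 + 2 * (k + 1) := ⟨m - i - 2, by omega⟩
    have h1 := pascalHalf_add i (k + 1)
    have h2 := pascalHalf_add (i + 2) k
    have h3 := pascalHalf_add (i + 1) (k + 1)
    rw [show i.succ - 1 = i by omega, show i.succ + 1 = i + 2 by omega,
      if_neg (by omega), one_mul, hk]
    rw [show i + 1 + 2 * (k + 1) - 1 = i + 2 * (k + 1) by omega, h1,
      show i + 2 * (k + 1) = i + 2 + 2 * k by ring, h2, Nat.succ_eq_add_one, h3,
      show i + 1 + 2 * (k + 1) = (i + 2 + 2 * k) + 1 by ring, Nat.choose_succ_succ]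
    push_cast
    ring

/-- The relations express every entry of column `j + 1` not fixed to be zero through column `j`,
whatever the coefficients `g`. -/
lemma IsDeformedCatalanTriangle.unique {g : ℕ → ℂ} {C C' : ℕ → ℕ → ℂ}
    (h : IsDeformedCatalanTriangle g C) (h' : IsDeformedCatalanTriangle g C') (i j : ℕ) :
    C i j = C' i j := by
  induction j generalizing i with
  | zero =>
    rcases Nat.eq_zero_or_pos i with rfl | hi
    · rw [h.zero_zero, h'.zero_zero]
    · rw [h.upper _ _ hi, h'.upper _ _ hi]
  | succ j ih =>
    rcases lt_trichotomy i (j + 1) with hij | rfl | hij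
    · rcases Nat.even_or_odd (i + (j + 1)) with he | ho
      · rcases Nat.eq_zero_or_pos i with rfl | hi
        · rw [zero_add] at he
          have hj : 2 ≤ j + 1 := by
            obtain ⟨m, hm⟩ := he
            omega
          rw [← h.first_row _ hj he, ← h'.first_row _ hj he, Nat.add_sub_cancel, ih]
        · rw [← h.step _ _ he hi hij, ← h'.step _ _ he hi hij, Nat.add_sub_cancel, ih, ih]
      · rw [h.even _ _ ho, h'.even _ _ ho]
    · rw [← h.diag _ (Nat.succ_pos j), ← h'.diag _ (Nat.succ_pos j), Nat.succ_sub_one, ih]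
    · rw [h.upper _ _ hij, h'.upper _ _ hij]

lemma isDeformedCatalanTriangle_iff (C : ℕ → ℕ → ℂ) :
    IsDeformedCatalanTriangle (fun i => if i = 0 then 2 else 1) C ↔
      ∀ i j : ℕ, C i j =
        if i ≤ j ∧ Even (i + j) then ((Nat.choose j ((j - i) / 2) : ℕ) : ℂ) else 0 := by
  constructor
  · intro h i j
    exact h.unique isDeformedCatalanTriangle_pascalHalf i j
  · intro h
    obtain rfl : C = pascalHalf := funext fun i => funext fun j => h i j
    exact isDeformedCatalanTriangle_pascalHalf

/-! ### The eigenvalues of one-column partitions -/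

lemma isPartition_col (n r : ℕ) : IsPartition (col n r) := by
  constructor
  · intro i j hij
    have : (i : ℕ) ≤ j := hij
    simp only [col]
    split_ifs <;> omega
  · intro i
    rw [col]
    split_ifs <;> simp

/-- Adding `(1^r)` to `ρ` moves each of the first `r` entries to the previous exponent, so the
differences telescope. -/
lemma eigenvalueDD_col {n r : ℕ} (hr : r ≤ n) {q : ℂ} (hq : q ≠ 0) :
    eigenvalueDD q q (col n r) =
      q ^ n + (q ^ n)⁻¹ - (q ^ (n - r) + (q ^ (n - r))⁻¹) := by
  set g : ℕ → ℂ := fun m => q ^ (n - m) + (q ^ (n - m))⁻¹ with hg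
  have h : ∀ i : Fin n, (q ^ (col n r + rhoD n) i + (q ^ (col n r + rhoD n) i)⁻¹) -
      (q ^ rhoD n i + (q ^ rhoD n i)⁻¹) =
      if (i : ℕ) < r then g i - g (i + 1) else 0 := by
    intro i
    have h1 : rhoD n i = ((n - (i + 1) : ℕ) : ℤ) := by
      rw [rhoD]
      omega
    rw [Pi.add_apply, col]
    split_ifs
    · have h2 : 1 + rhoD n i = ((n - i : ℕ) : ℤ) := by
        rw [rhoD]
        omega
      rw [h2, h1, zpow_natCast, zpow_natCast]
    · rw [zero_add, sub_self]
  rw [eigenvalueDD_eq hq, shiftEigen, shiftEigen, ← Finset.sum_sub_distrib,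
    Finset.sum_congr rfl fun i _ => h i,
    Fin.sum_univ_eq_sum_range (fun i => if i < r then g i - g (i + 1) else 0), ← Finset.sum_filter]
  have hfilter : (Finset.range n).filter (· < r) = Finset.range r := by
    ext i
    simp only [Finset.mem_filter, Finset.mem_range]
    omega
  rw [hfilter, Finset.sum_range_sub']
  simp [hg]

/-- Equality of `z + z⁻¹` and `w + w⁻¹` means `(z - w)(zw - 1) = 0`. By `0 < |q| < 1`, either factor
forces `a = b`, the second through `a + b = 0`. -/
lemma pow_add_inv_injective {q : ℂ} (hq0 : q ≠ 0) (hq1 : ‖q‖ < 1) {a b : ℕ}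
    (h : q ^ a + (q ^ a)⁻¹ = q ^ b + (q ^ b)⁻¹) : a = b := by
  have ha := pow_ne_zero a hq0
  have hb := pow_ne_zero b hq0
  have hprod : (q ^ a - q ^ b) * (q ^ (a + b) - 1) = 0 := by
    field_simp at h
    rw [pow_add]
    linear_combination h
  rcases mul_eq_zero.1 hprod with h | h
  · have h1 := congrArg norm (sub_eq_zero.1 h)
    rw [norm_pow, norm_pow] at h1
    exact pow_right_injective₀ (norm_pos_iff.2 hq0) hq1.ne h1
  · have h1 := congrArg norm (sub_eq_zero.1 h)
    rw [norm_pow, norm_one] at h1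
    by_contra hab
    exact hq1.ne ((pow_eq_one_iff_of_nonneg (norm_nonneg q) (by omega)).1 h1)

/-- The first partial sum bounds the largest part by 1, so only entries 0 and 1 occur. The column
with as many ones lies in the same orbit, and two dominant weights in one orbit dominate each other.
-/
lemma eq_col_of_domLE {n r : ℕ} (hn : 0 < n) {mu : Fin n → ℤ} (hmu : IsPartition mu)
    (h : DomLE mu (col n r)) : ∃ s ≤ n, mu = col n s := by
  have h0 : mu ⟨0, hn⟩ ≤ 1 := by
    have h1 := h ⟨0, hn⟩
    have h2 : Finset.Iic (⟨0, hn⟩ : Fin n) = {⟨0, hn⟩} := by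
      ext i
      simp only [Finset.mem_Iic, Finset.mem_singleton, Fin.le_def, Fin.ext_iff]
      omega
    rw [h2, Finset.sum_singleton, Finset.sum_singleton] at h1
    refine h1.trans ?_
    rw [col]
    split_ifs <;> simp
  have habs : ∀ i, |mu i| ≤ 1 := fun i => by
    rw [abs_of_nonneg (hmu.2 i)]
    exact (hmu.1 (Fin.mk_le_of_le_val (Nat.zero_le _))).trans h0
  have hmem : mu ∈ orbit (col n (numNonzero mu)) :=
    (mem_orbit_col (numNonzero_le mu)).2 ⟨habs, rfl⟩
  refine ⟨_, numNonzero_le mu, ?_⟩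
  have hcol := isPartition_col n (numNonzero mu)
  have hmem' : col n (numNonzero mu) ∈ orbit mu := by
    obtain ⟨σ, hσ⟩ := mem_orbit.1 hmem
    exact mem_orbit.2 ⟨σ⁻¹, fun i => by simpa using (hσ (σ⁻¹ i)).symm⟩
  exact (domLE_of_mem_orbit hcol.1 hcol.2 hmem).antisymm (domLE_of_mem_orbit hmu.1 hmu.2 hmem')

lemma eigenvalueDD_ne_of_domLT_col {n r : ℕ} (hn : 0 < n) (hr : r ≤ n) {q : ℂ} (hq0 : q ≠ 0)
    (hq1 : ‖q‖ < 1) {mu : Fin n → ℤ} (hmu : IsPartition mu) (h : DomLT mu (col n r)) :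
    eigenvalueDD q q mu ≠ eigenvalueDD q q (col n r) := by
  obtain ⟨s, hs, rfl⟩ := eq_col_of_domLE hn hmu h.1
  intro he
  rw [eigenvalueDD_col hs hq0, eigenvalueDD_col hr hq0, sub_right_inj] at he
  have := pow_add_inv_injective hq0 hq1 he
  exact h.2 (by rw [show s = r by omega])

end KoornwinderD

end

theorem corollary1p3 (n : ℕ) (hn : 0 < n) (q : ℂ) (hq0 : q ≠ 0) (hq1 : ‖q‖ < 1) :
    -- at `b = 1`, `t = q` the Macdonald polynomials are the Schur polynomials of type `Dₙ`
    (∀ lam : Fin n → ℤ, KoornwinderD.IsPartition lam →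
      ∃ s : KoornwinderD.Laurent n,
        KoornwinderD.toRat s = KoornwinderD.schurD lam ∧
        KoornwinderD.IsMacdonaldCC 1 q q lam s ∧
        KoornwinderD.IsMacdonaldDD q q lam s ∧
        ((∀ mu : Fin n → ℤ, KoornwinderD.IsPartition mu → KoornwinderD.DomLT mu lam →
            KoornwinderD.eigenvalueDD q q mu ≠ KoornwinderD.eigenvalueDD q q lam) →
          ∀ P : KoornwinderD.Laurent n,
            (KoornwinderD.IsMacdonaldCC 1 q q lam P → P = s) ∧
            (KoornwinderD.IsMacdonaldDD q q lam P → P = s))) ∧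
    -- the values of `f` at `a = 1`, `c = q^{1/2}`, `t = q`
    KoornwinderD.FHasValueAt 0 (1, q ^ (1 / 2 : ℂ), q) 2 ∧
    (∀ i : ℕ, 0 < i → KoornwinderD.FHasValueAt i (1, q ^ (1 / 2 : ℂ), q) 1) ∧
    -- the recursion relations reduce to those of the half of the Pascal triangle
    (∀ C : ℕ → ℕ → ℂ,
      KoornwinderD.IsDeformedCatalanTriangle (fun i => if i = 0 then 2 else 1) C ↔
        ∀ i j : ℕ, C i j =
          if i ≤ j ∧ Even (i + j) then ((Nat.choose j ((j - i) / 2) : ℕ) : ℂ) else 0) ∧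
    -- one-column diagrams
    (∀ r : ℕ, r ≤ n →
      (∀ P : KoornwinderD.Laurent n,
        KoornwinderD.IsMacdonaldCC 1 q q (KoornwinderD.col n r) P ↔
          P = KoornwinderD.Epoly n r) ∧
      (∀ P : KoornwinderD.Laurent n,
        KoornwinderD.IsMacdonaldDD q q (KoornwinderD.col n r) P ↔
          P = KoornwinderD.Epoly n r) ∧
      KoornwinderD.schurD (KoornwinderD.col n r) =
        KoornwinderD.toRat (KoornwinderD.Epoly n r) ∧
      KoornwinderD.Epoly n r =
        ∑ k ∈ Finset.range (r / 2 + 1),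
          Nat.choose (n - r + 2 * k) k • KoornwinderD.msym (KoornwinderD.col n (r - 2 * k))) := by
  have hgen : ∀ lam : Fin n → ℤ, KoornwinderD.IsPartition lam →
      ∃ s : KoornwinderD.Laurent n,
        KoornwinderD.altC (KoornwinderD.rhoD n) * s =
          KoornwinderD.altC (lam + KoornwinderD.rhoD n) ∧
        KoornwinderD.toRat s = KoornwinderD.schurD lam ∧
        KoornwinderD.IsMacdonaldDD q q lam s := by
    intro lam hlam
    obtain ⟨s, h1, h2⟩ := KoornwinderD.exists_schur hlam
    exact ⟨s, h2, (KoornwinderD.schurD_eq_of_mul_eq hn hlam h2).symm,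
      KoornwinderD.isMacdonaldDD_of_mul_eq hq0 h1 h2⟩
  simp only [KoornwinderD.isMacdonaldCC_one_iff]
  refine ⟨fun lam hlam => ?_, KoornwinderD.fHasValueAt_zero hq0 hq1,
    fun i hi => KoornwinderD.fHasValueAt_pos hq0 hq1 hi,
    KoornwinderD.isDeformedCatalanTriangle_iff, fun r hr => ?_⟩
  · obtain ⟨s, -, h2, h3⟩ := hgen lam hlam
    exact ⟨s, h2, h3, h3, fun hd P => ⟨fun hP => hP.unique hq0 h3 hd,
      fun hP => hP.unique hq0 h3 hd⟩⟩
  · obtain ⟨s, h1, h2, h3⟩ := hgen _ (KoornwinderD.isPartition_col n r)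
    -- Both sides have product `altC ((1^r) + ρ)` with Δ, which can be cancelled.
    have hs : s = KoornwinderD.Epoly n r :=
      mul_left_cancel₀ (KoornwinderD.altC_rhoD_ne_zero n)
        (h1.trans (KoornwinderD.altC_rhoD_mul_Epoly hr).symm)
    subst hs
    have hiff : ∀ P : KoornwinderD.Laurent n,
        KoornwinderD.IsMacdonaldDD q q (KoornwinderD.col n r) P ↔ P = KoornwinderD.Epoly n r :=
      fun P => ⟨fun hP => hP.unique hq0 h3 fun mu hmu hlt =>
        KoornwinderD.eigenvalueDD_ne_of_domLT_col hn hr hq0 hq1 hmu hlt, fun hP => hP ▸ h3⟩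
    exact ⟨hiff, hiff, h2.symm, KoornwinderD.Epoly_eq_sum_msym hr⟩
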